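/- Let $j\in L^1(\mathbb R^d)$ be of the form $j(x)=(2\pi)^{-d}\int_{\mathbb R^d}e^{ix\cdot t}\,d\rho(t)$ for all $x$, with $\rho$ a finite (positive) measure on $\mathbb R^d$, let $J$ be the bounded integral operator on $L^2(\mathbb R^d)$ with kernel $J(x,y)=j(x-y)$, and assume that the interaction range $R:=\inf\{R'\in\mathbb R: j(x)=0\text{ whenever }|x|\ge R'\}\in[-\infty,\infty]$ satisfies $R>0$. Let $\mathcal N$ be the set of configurations, i.e. of locally finite integer-valued measures $\xi=\sum_i k_i\delta_{x_i}$ on $\mathbb R^d$, regarded as collections of points with multiplicities. For $D\subset\mathbb R^d$ let $\xi_D$ be the restriction of $\xi$ to $D$, and let $\mathcal F_D$ be the $\sigma$-algebra generated by $\xi\mapsto\xi(B)$, $B\subset D$ bounded Borel; $\mathcal F:=\mathcal F_{\mathbb R^d}$. Write $\Lambda\subset\subset\mathbb R^d$ if $\Lambda$ is a bounded Borel set, and let $\Gamma_\Lambda$ be the set of (finite) configurations in $\Lambda$ without multiple points. For finite configurations put $U(x_1,\dots,x_n):=-\log\det(j(x_i-x_k))_{i,k\le n}\in\mathbb R\cup\{+\infty\}$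 ($-\log 0:=+\infty$, $U(\emptyset):=0$), and $W(\zeta;\eta):=U(\zeta\eta)-U(\zeta)-U(\eta)$ if $U(\zeta\eta)<\infty$, $W(\zeta;\eta):=+\infty$ otherwise, where $\zeta\eta$ is the union of $\zeta$ and $\eta$, with multiplicities. For $\Lambda\subset\subset\mathbb R^d$ and $\xi\in\mathcal N$ let $\xi_{\partial\Lambda}:=\xi_{\Lambda^c}$ if $R=\infty$; if $R<\infty$ let $\xi_{\partial\Lambda}$ consist of those particles $x$ of $\xi_{\Lambda^c}$ for which there are $k\ge1$, a point $p_0\in\Lambda$ and particles $p_1,\dots,p_k=x$ of $\xi_{\Lambda^c}$ with $|p_l-p_{l-1}|<R$ for $1\le l\le k$. For $D\subset\Lambda^c$ let $\widehat\xi_D$ be the restriction of $\xi_{\partial\Lambda}$ to $D$. Let $$\mathcal R_\Lambda:=\{\xi\in\mathcal N:\ \det J(\widehat\xi_\Delta,\widehat\xi_\Delta)\ne0\ \text{ for all bounded Borel }\Delta\subset\Lambda^c\},$$ where $J(\eta,\eta)=(j(y-y'))_{y,y'\in\eta}$, and, for $\Delta\subset\subset\mathbb R^d$, $H_{\Lambda;\Delta}(\zeta;\xi):=U(\zeta)+W(\zeta;\widehat\xi_{\Delta\setminus\Lambda})$.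 (a) For every $\Lambda\subset\subset\mathbb R^d$, $\zeta\in\Gamma_\Lambda$ and $\xi\in\mathcal R_\Lambda$, $H_{\Lambda;\Delta}(\zeta;\xi)$ is nondecreasing in $\Delta\subset\subset\mathbb R^d$, and the limit $H_\Lambda(\zeta;\xi):=\lim_{\Delta\uparrow\mathbb R^d}H_{\Lambda;\Delta}(\zeta;\xi)\in(-\infty,+\infty]$ exists (along the bounded Borel sets directed by inclusion). Put $H_\Lambda(\zeta;\xi):=+\infty$ if $\zeta\notin\Gamma_\Lambda$ or $\xi\notin\mathcal R_\Lambda$. Then $(x_1,\dots,x_n)\mapsto H_\Lambda(x_1,\dots,x_n;\xi)$ is measurable for all $\Lambda$, $\xi$, $n$. (b) Let $Z_\Lambda(\xi):=\sum_{n\ge0}\frac1{n!}\int_{\Lambda^n}e^{-H_\Lambda(x_1,\dots,x_n;\xi)}\,dx_1\cdots dx_n$ and $J_\Lambda:=P_\Lambda JP_\Lambda$, with $P_\Lambda$ the projection of $L^2(\mathbb R^d)$ onto $L^2(\Lambda)$. Then $J_\Lambda$ is trace class and, for all $\xi\in\mathcal R_\Lambda$, $$1\le Z_\Lambda(\xi)\le\det(I+J_\Lambda),$$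 where $\det(I+T)=\sum_{n\ge0}\operatorname{Tr}(\wedge^nT)$ is the Fredholm determinant. (c) Let $\gamma_\Lambda(\zeta;\xi):=Z_\Lambda(\xi)^{-1}e^{-H_\Lambda(\zeta;\xi)}$ if $\zeta\in\Gamma_\Lambda$, $\xi\in\mathcal R_\Lambda$, and $:=0$ otherwise. For every $\xi\in\mathcal N$ the formula $$\gamma_\Lambda(f|\xi):=\sum_{n\ge0}\frac1{n!}\int_{\Lambda^n}\gamma_\Lambda(x_1,\dots,x_n;\xi)\,f\big(\{x_1,\dots,x_n\}\,\xi_{\Lambda^c}\big)\,dx_1\cdots dx_n,\qquad f:\mathcal N\to\mathbb R\text{ bounded measurable},$$ is a convergent series and is the integral of $f$ with respect to a measure $\gamma_\Lambda(\cdot|\xi)$ on $(\mathcal N,\mathcal F)$. The system $(\gamma_\Lambda)_{\Lambda\subset\subset\mathbb R^d}$ is a specification with respect to $(\mathcal R_\Lambda)_{\Lambda\subset\subset\mathbb R^d}$, i.e. for all $\Lambda\subset\subset\mathbb R^d$: $\mathcal R_\Lambda\in\mathcal F_{\Lambda^c}$; (i) $\gamma_\Lambda(\cdot|\xi)$ is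 a probability measure for $\xi\in\mathcal R_\Lambda$; (ii) $\gamma_\Lambda(A|\xi)=0$ for $\xi\notin\mathcal R_\Lambda$, $A\in\mathcal F$; (iii) $\gamma_\Lambda(A|\cdot)$ is $\mathcal F_{\Lambda^c}$-measurable for $A\in\mathcal F$; (iv) $\gamma_\Lambda(A|\cdot)=1_{A\cap\mathcal R_\Lambda}$ for $A\in\mathcal F_{\Lambda^c}$; (v) $\int\gamma_\Delta(d\zeta|\xi)\,\gamma_\Lambda(A|\zeta)=\gamma_\Delta(A|\xi)$ for $\Lambda\subset\Delta\subset\subset\mathbb R^d$, $A\in\mathcal F$, $\xi\in\mathcal N$. -/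

import Mathlib

open MeasureTheory Filter Topology Set
open scoped ENNReal Nat

namespace DetGibbs

noncomputable section

/-! ### The one-particle space and bounded Borel regions -/

/-- The one-particle space `ℝ^d`. -/
abbrev Pt (d : ℕ) : Type := EuclideanSpace ℝ (Fin d)

/-- The bounded Borel subsets of `ℝ^d`, ordered by inclusion. Limits as `Δ ↑ ℝ^d` are limits along
`atTop` in this directed set. -/
abbrev Region (d : ℕ) : Type := {Λ : Set (Pt d) // MeasurableSet Λ ∧ Bornology.IsBounded Λ}

/-! ### Configurations -/

/-- A configuration `ξ = ∑ₓ k(x) δ_x` on `ℝ^d`, i.e. a locally finite integer-valued measure, given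
by its multiplicity function `k`. -/
@[ext] structure Config (d : ℕ) where
  mult : Pt d → ℕ
  locallyFinite : ∀ s : Set (Pt d), Bornology.IsBounded s → {x ∈ s | mult x ≠ 0}.Finite

namespace Config

variable {d : ℕ}

/-- The number `N_B(ξ) = ξ(B)` of particles (with multiplicity) in a bounded set `B`. -/
def count (ξ : Config d) (B : Set (Pt d)) : ℕ := ∑ᶠ x ∈ B, ξ.mult x

/-- The finite collection of particles of `ξ` (with multiplicity) in a bounded set `D`. -/
def pts (ξ : Config d) (D : Set (Pt d)) : Multiset (Pt d) :=
  ∑ᶠ x ∈ D, Multiset.replicate (ξ.mult x) x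

open Classical in
/-- The restriction `ξ_D` of a configuration to a set `D`. -/
def restrict (ξ : Config d) (D : Set (Pt d)) : Config d where
  mult x := if x ∈ D then ξ.mult x else 0
  locallyFinite s hs := (ξ.locallyFinite s hs).subset fun x hx => by
    refine ⟨hx.1, fun h => hx.2 ?_⟩
    simp [h]

open Classical in
/-- The configuration `ζ_Λ ξ_{Λᶜ}` formed by the finitely many particles `ζ` and by the particles of
`ξ` outside `Λ`. -/
def glue (Λ : Set (Pt d)) (ζ : Multiset (Pt d)) (ξ : Config d) : Config d where
  mult x := ζ.count x + (ξ.restrict Λᶜ).mult x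
  locallyFinite s hs := by
    refine ((ζ.toFinset.finite_toSet).union ((ξ.restrict Λᶜ).locallyFinite s hs)).subset ?_
    rintro x ⟨hxs, hx⟩
    by_cases h : (ξ.restrict Λᶜ).mult x = 0
    · left
      rw [h, add_zero] at hx
      simpa [Multiset.count_eq_zero] using hx
    · exact Or.inr ⟨hxs, h⟩

/-- The σ-algebra `𝓕_D` generated by the counts `N_B`, for `B` a bounded Borel subset of `D`. -/
@[reducible] def sigmaOn (D : Set (Pt d)) : MeasurableSpace (Config d) :=
  ⨆ B : {B : Set (Pt d) // MeasurableSet B ∧ Bornology.IsBounded B ∧ B ⊆ D},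
    MeasurableSpace.comap (fun ξ => ξ.count B.1) ⊤

/-- The σ-algebra `𝓕` on configurations. -/
instance : MeasurableSpace (Config d) := sigmaOn Set.univ

end Config

/-- The collection of points of a tuple `(x₁, …, xₙ)`. -/
def tuplePts {d n : ℕ} (x : Fin n → Pt d) : Multiset (Pt d) :=
  (Finset.univ : Finset (Fin n)).val.map x

/-- The simple configurations `Γ_Λ` in the bounded region `Λ`. -/
def simpleIn {d : ℕ} (Λ : Set (Pt d)) : Set (Multiset (Pt d)) :=
  {ζ | ζ.Nodup ∧ ∀ x ∈ ζ, x ∈ Λ}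

/-! ### The interaction -/

/-- The assumption on the kernel `J(x,y) = j(x - y)`: `j` is integrable and is the inverse Fourier
transform of a finite measure. -/
structure IsAdmissible {d : ℕ} (j : Pt d → ℂ) : Prop where
  integrable : Integrable j
  fourier : ∃ ρ : Measure (Pt d), IsFiniteMeasure ρ ∧
    ∀ x, j x = (((2 * Real.pi) ^ d)⁻¹ : ℝ) *
      ∫ t, Complex.exp (Complex.I * ((inner ℝ x t : ℝ) : ℂ)) ∂ρ

variable {d : ℕ}

open Classical in
/-- `det (j(xᵢ - xₖ))`, the points being taken with multiplicity. -/
def gramDet (j : Pt d → ℂ) (s : Multiset (Pt d)) : ℂ :=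
  Matrix.det (Matrix.of fun a b : s => j (a.1 - b.1))

/-- The potential energy `U(x₁, …, xₙ) = - log det (j(xᵢ - xₖ))`, with `- log 0 = +∞`. The
determinant is a nonnegative real number when `j` is of positive type. -/
def energy (j : Pt d → ℂ) (s : Multiset (Pt d)) : EReal :=
  -ENNReal.log (ENNReal.ofReal (gramDet j s).re)

open Classical in
/-- The mutual potential energy `W(ζ; η)`. -/
def mutualEnergy (j : Pt d → ℂ) (ζ η : Multiset (Pt d)) : EReal :=
  if energy j (ζ + η) = ⊤ then ⊤ else energy j (ζ + η) - energy j ζ - energy j η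

/-- The interaction range `R = inf {R' ∈ ℝ : j(x) = 0 whenever |x| ≥ R'}`, possibly `+∞`. -/
def interactionRange (j : Pt d → ℂ) : EReal :=
  sInf {r : EReal | ∃ r' : ℝ, r = (r' : EReal) ∧ ∀ x : Pt d, r' ≤ ‖x‖ → j x = 0}

/-- The particle of `ξ` at `x ∉ Λ` interacts with `Λ`: a chain with steps of length `< R` leads to
`x` from a point of `Λ` through particles of `ξ` outside `Λ`. -/
def Interacts (j : Pt d → ℂ) (Λ : Set (Pt d)) (ξ : Config d) (x : Pt d) : Prop :=
  ∃ (k : ℕ) (p : ℕ → Pt d), 1 ≤ k ∧ p 0 ∈ Λ ∧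
    (∀ l, 1 ≤ l → l ≤ k → p l ∈ Λᶜ ∧ ξ.mult (p l) ≠ 0) ∧ p k = x ∧
    ∀ l < k, ((dist (p (l + 1)) (p l) : ℝ) : EReal) < interactionRange j

open Classical in
/-- The boundary particles `ξ_∂Λ`. If `R = ∞` these are all particles outside `Λ`. -/
def boundary (j : Pt d → ℂ) (Λ : Set (Pt d)) (ξ : Config d) : Config d :=
  if interactionRange j = ⊤ then ξ.restrict Λᶜ else ξ.restrict {x | Interacts j Λ ξ x}

/-- The event `𝓡_Λ` of possible boundary conditions: `det J(ξ̂_Δ, ξ̂_Δ) ≠ 0` for all bounded Borel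
sets `Δ ⊆ Λᶜ`, where `ξ̂_Δ = ξ_Δ ∩ ξ_∂Λ`. -/
def possible (j : Pt d → ℂ) (Λ : Region d) : Set (Config d) :=
  {ξ | ∀ Δ : Region d, Δ.1 ⊆ Λ.1ᶜ → gramDet j ((boundary j Λ.1 ξ).pts Δ.1) ≠ 0}

/-- The finite-volume energy `U(ζ_Λ) + W(ζ_Λ; ξ̂_{Δ ∖ Λ})`. -/
def hamOn (j : Pt d → ℂ) (Λ Δ : Region d) (ζ : Multiset (Pt d)) (ξ : Config d) : EReal :=
  energy j ζ + mutualEnergy j ζ ((boundary j Λ.1 ξ).pts (Δ.1 \ Λ.1))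

open Classical in
/-- The energy `H_Λ(ζ; ξ)` with boundary condition `ξ`, the limit of the finite-volume energies as
`Δ ↑ ℝ^d`; it is `+∞` unless `ζ ∈ Γ_Λ` and `ξ ∈ 𝓡_Λ`. -/
def ham (j : Pt d → ℂ) (Λ : Region d) (ζ : Multiset (Pt d)) (ξ : Config d) : EReal :=
  if ζ ∈ simpleIn Λ.1 ∧ ξ ∈ possible j Λ then
    limUnder atTop (fun Δ : Region d => hamOn j Λ Δ ζ ξ)
  else ⊤

/-! ### The Gibbsian kernels -/

/-- The set `Λⁿ`. -/
def cube (Λ : Set (Pt d)) (n : ℕ) : Set (Fin n → Pt d) := Set.univ.pi fun _ => Λ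

/-- The partition function `Z_Λ(ξ) = ∑ₙ (1/n!) ∫_{Λⁿ} exp(-H_Λ(x₁, …, xₙ; ξ)) dx`. -/
def partitionFn (j : Pt d → ℂ) (Λ : Region d) (ξ : Config d) : ℝ≥0∞ :=
  ∑' n : ℕ, ((n ! : ℕ) : ℝ≥0∞)⁻¹ *
    ∫⁻ x in cube Λ.1 n, EReal.exp (-ham j Λ (tuplePts x) ξ)

open Classical in
/-- The density `γ_Λ(ζ; ξ)`. -/
def density (j : Pt d → ℂ) (Λ : Region d) (ζ : Multiset (Pt d)) (ξ : Config d) : ℝ≥0∞ :=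
  if ζ ∈ simpleIn Λ.1 ∧ ξ ∈ possible j Λ then
    (partitionFn j Λ ξ)⁻¹ * EReal.exp (-ham j Λ ζ ξ)
  else 0

/-- The kernel `γ_Λ(· | ξ)`, the measure
`A ↦ ∑ₙ (1/n!) ∫_{Λⁿ} γ_Λ(x₁, …, xₙ; ξ) 1_A(x₁ ⋯ xₙ ξ_{Λᶜ}) dx`. -/
def kernel (j : Pt d → ℂ) (Λ : Region d) (ξ : Config d) : Measure (Config d) :=
  Measure.sum fun n : ℕ => ((n ! : ℕ) : ℝ≥0∞)⁻¹ •
    (((volume : Measure (Fin n → Pt d)).restrict (cube Λ.1 n)).withDensity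
      fun x => density j Λ (tuplePts x) ξ).map fun x => Config.glue Λ.1 (tuplePts x) ξ

/-- `γ` is a specification with respect to the family of events `R`. -/
structure IsSpecification (R : Region d → Set (Config d))
    (γ : Region d → Config d → Measure (Config d)) : Prop where
  measurableSet_possible : ∀ Λ, MeasurableSet[Config.sigmaOn Λ.1ᶜ] (R Λ)
  isProbabilityMeasure : ∀ Λ, ∀ ξ ∈ R Λ, IsProbabilityMeasure (γ Λ ξ)
  eq_zero : ∀ Λ, ∀ ξ ∉ R Λ, ∀ A, MeasurableSet A → γ Λ ξ A = 0
  measurable : ∀ Λ A, MeasurableSet A → Measurable[Config.sigmaOn Λ.1ᶜ] fun ξ => γ Λ ξ A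
  proper : ∀ Λ A, MeasurableSet[Config.sigmaOn Λ.1ᶜ] A →
    ∀ ξ, γ Λ ξ A = (A ∩ R Λ).indicator (fun _ => 1) ξ
  consistent : ∀ Λ Δ, Λ.1 ⊆ Δ.1 → ∀ A, MeasurableSet A →
    ∀ ξ, ∫⁻ ζ, γ Λ ζ A ∂(γ Δ ξ) = γ Δ ξ A

/-! ### Fredholm determinants -/

section Fredholm

variable {H : Type} [NormedAddCommGroup H] [InnerProductSpace ℂ H]

open Classical in
/-- `c = Tr(⋀ⁿ T)`. For an orthonormal basis `(eᵢ)` of `H` the vectors `e_S = ⋀_{i ∈ S} eᵢ`, `|S| = n`,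
form an orthonormal basis of `⋀ⁿ H`, and `⟪e_S, (⋀ⁿ T) e_S⟫ = det (⟪eᵢ, T eₖ⟫)_{i,k ∈ S}`. The sum
over `S` is required to converge, to the same value, for every orthonormal basis. -/
def HasExteriorTrace (T : H →L[ℂ] H) (n : ℕ) (c : ℂ) : Prop :=
  ∀ (ι : Type) (e : HilbertBasis ι ℂ H),
    HasSum (fun S : {S : Finset ι // S.card = n} =>
      Matrix.det (Matrix.of fun a b : S.1 => inner ℂ (e a.1) (T (e b.1)))) c

/-- `D` is the Fredholm determinant `det (I + T) = ∑ₙ Tr(⋀ⁿ T)`. (The condition for `n = 1` makes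
`T` trace class.) -/
def HasFredholmDet (T : H →L[ℂ] H) (D : ℂ) : Prop :=
  ∃ c : ℕ → ℂ, (∀ n, HasExteriorTrace T n (c n)) ∧ HasSum c D

theorem HasFredholmDet.unique [CompleteSpace H] {T : H →L[ℂ] H} {D D' : ℂ}
    (h : HasFredholmDet T D) (h' : HasFredholmDet T D') : D = D' := by
  obtain ⟨c, hc, hD⟩ := h
  obtain ⟨c', hc', hD'⟩ := h'
  obtain ⟨w, b, -⟩ := exists_hilbertBasis ℂ H
  have : c = c' := funext fun n => (hc n _ b).unique (hc' n _ b)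
  subst this
  exact hD.unique hD'

end Fredholm

/-! ### The integral operator -/

/-- The Hilbert space `L²(ℝ^d)`. -/
abbrev L2 (d : ℕ) : Type := Lp ℂ 2 (volume : Measure (Pt d))

/-- The function `x ↦ ∫ j(x - y) f(y) dy`. -/
def convFun (j f : Pt d → ℂ) (x : Pt d) : ℂ := ∫ y, j (x - y) * f y

theorem enorm_convFun_sq_lintegral_le {j f : Pt d → ℂ} (hj : Integrable j)
    (hf : AEStronglyMeasurable f volume) :
    ∫⁻ x, (∫⁻ y, ‖j (x - y) * f y‖ₑ) ^ 2 ≤ (∫⁻ x, ‖j x‖ₑ) ^ 2 * ∫⁻ y, ‖f y‖ₑ ^ 2 := by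
  have hjm : AEMeasurable (fun x => ‖j x‖ₑ) volume := hj.1.enorm
  have hfm : AEMeasurable (fun x => ‖f x‖ₑ) volume := hf.enorm
  have hsub : ∀ x : Pt d, ∫⁻ y, ‖j (x - y)‖ₑ = ∫⁻ y, ‖j y‖ₑ := fun x =>
    lintegral_sub_left_eq_self (fun y => ‖j y‖ₑ) x
  have hsub' : ∀ y : Pt d, ∫⁻ x, ‖j (x - y)‖ₑ = ∫⁻ x, ‖j x‖ₑ := fun y =>
    lintegral_sub_right_eq_self (fun x => ‖j x‖ₑ) y
  have hjx : ∀ x : Pt d, AEMeasurable (fun y => ‖j (x - y)‖ₑ) volume := fun x =>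
    hjm.comp_quasiMeasurePreserving (quasiMeasurePreserving_sub_left volume x)
  have hpt : ∀ x : Pt d, (∫⁻ y, ‖j (x - y) * f y‖ₑ) ^ 2 ≤
      (∫⁻ y, ‖j y‖ₑ) * ∫⁻ y, ‖j (x - y)‖ₑ * ‖f y‖ₑ ^ 2 := by
    intro x
    have h2 : Real.HolderConjugate 2 2 := Real.HolderConjugate.two_two
    have hcs := ENNReal.lintegral_mul_le_Lp_mul_Lq volume h2
      (f := fun y : Pt d => ‖j (x - y)‖ₑ ^ (1 / 2 : ℝ))
      (g := fun y : Pt d => ‖j (x - y)‖ₑ ^ (1 / 2 : ℝ) * ‖f y‖ₑ)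
      ((hjx x).pow_const _) (((hjx x).pow_const _).mul hfm)
    have hhalf : ∀ a : ℝ≥0∞, a ^ (1 / 2 : ℝ) * a ^ (1 / 2 : ℝ) = a := by
      intro a
      rw [← ENNReal.rpow_add_of_nonneg _ _ (by norm_num) (by norm_num)]
      norm_num
    have hsq : ∀ a : ℝ≥0∞, (a ^ (1 / 2 : ℝ)) ^ (2 : ℝ) = a := by
      intro a
      rw [← ENNReal.rpow_mul]
      norm_num
    have e1 : ∫⁻ y, ‖j (x - y) * f y‖ₑ = ∫⁻ y, ((fun y => ‖j (x - y)‖ₑ ^ (1 / 2 : ℝ)) *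
        fun y => ‖j (x - y)‖ₑ ^ (1 / 2 : ℝ) * ‖f y‖ₑ) y := by
      refine lintegral_congr fun y => ?_
      simp only [Pi.mul_apply]
      rw [← mul_assoc, hhalf, enorm_mul]
    rw [e1]
    refine (pow_le_pow_left' hcs 2).trans (le_of_eq ?_)
    simp only [hsq, ENNReal.mul_rpow_of_nonneg _ _ (by norm_num : (0 : ℝ) ≤ 2), mul_pow, hsub]
    simp only [← ENNReal.rpow_natCast, ← ENNReal.rpow_mul]
    norm_num
  calc ∫⁻ x, (∫⁻ y, ‖j (x - y) * f y‖ₑ) ^ 2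
      ≤ ∫⁻ x, (∫⁻ y, ‖j y‖ₑ) * ∫⁻ y, ‖j (x - y)‖ₑ * ‖f y‖ₑ ^ 2 := lintegral_mono hpt
    _ = (∫⁻ y, ‖j y‖ₑ) * ∫⁻ x, ∫⁻ y, ‖j (x - y)‖ₑ * ‖f y‖ₑ ^ 2 :=
        lintegral_const_mul' _ _ hj.2.ne
    _ = (∫⁻ y, ‖j y‖ₑ) * ∫⁻ y, ∫⁻ x, ‖j (x - y)‖ₑ * ‖f y‖ₑ ^ 2 := by
        rw [lintegral_lintegral_swap]
        have hm1 : AEMeasurable (fun p : Pt d × Pt d => ‖j (p.1 - p.2)‖ₑ)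
            (volume.prod volume) :=
          hjm.comp_quasiMeasurePreserving
            (quasiMeasurePreserving_sub (volume : Measure (Pt d)) (volume : Measure (Pt d)))
        have hm2 : AEMeasurable (fun p : Pt d × Pt d => ‖f p.2‖ₑ ^ 2) (volume.prod volume) :=
          (hfm.pow_const 2).comp_snd
        exact hm1.mul hm2
    _ = (∫⁻ y, ‖j y‖ₑ) * ∫⁻ y, (∫⁻ x, ‖j x‖ₑ) * ‖f y‖ₑ ^ 2 := by
        congr 1
        refine lintegral_congr fun y => ?_
        have hm : AEMeasurable (fun x : Pt d => ‖j (x - y)‖ₑ) volume :=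
          hjm.comp_quasiMeasurePreserving
            (measurePreserving_sub_right volume y).quasiMeasurePreserving
        rw [lintegral_mul_const'' _ hm, hsub']
    _ = (∫⁻ x, ‖j x‖ₑ) ^ 2 * ∫⁻ y, ‖f y‖ₑ ^ 2 := by
        rw [lintegral_const_mul' _ _ hj.2.ne]
        ring

theorem eLpNorm_two_sq {f : Pt d → ℂ} :
    eLpNorm f 2 volume ^ 2 = ∫⁻ x, ‖f x‖ₑ ^ 2 := by
  rw [eLpNorm_eq_lintegral_rpow_enorm_toReal (by norm_num) (by norm_num)]
  simp only [ENNReal.toReal_ofNat, ← ENNReal.rpow_natCast, ← ENNReal.rpow_mul]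
  norm_num

theorem aestronglyMeasurable_convFun {j f : Pt d → ℂ} (hj : Integrable j)
    (hf : AEStronglyMeasurable f volume) : AEStronglyMeasurable (convFun j f) volume := by
  have h : AEStronglyMeasurable (fun p : Pt d × Pt d => j (p.1 - p.2) * f p.2)
      (volume.prod volume) :=
    (hj.1.comp_quasiMeasurePreserving (quasiMeasurePreserving_sub volume volume)).mul hf.comp_snd
  exact h.integral_prod_right'

theorem eLpNorm_convFun_le {j f : Pt d → ℂ} (hj : Integrable j)
    (hf : AEStronglyMeasurable f volume) :
    eLpNorm (convFun j f) 2 volume ≤ (∫⁻ x, ‖j x‖ₑ) * eLpNorm f 2 volume := by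
  refine le_of_not_gt fun hlt => ?_
  have h1 : ((∫⁻ x, ‖j x‖ₑ) * eLpNorm f 2 volume) ^ 2 < eLpNorm (convFun j f) 2 volume ^ 2 :=
    ENNReal.pow_lt_pow_left two_ne_zero hlt
  rw [mul_pow, eLpNorm_two_sq, eLpNorm_two_sq] at h1
  refine absurd h1 (not_lt.2 (le_trans (lintegral_mono fun x => ?_)
    (enorm_convFun_sq_lintegral_le hj hf)))
  exact pow_le_pow_left' (enorm_integral_le_lintegral_enorm _) 2

theorem memLp_convFun {j f : Pt d → ℂ} (hj : Integrable j) (hf : MemLp f 2 volume) :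
    MemLp (convFun j f) 2 volume :=
  ⟨aestronglyMeasurable_convFun hj hf.1, (eLpNorm_convFun_le hj hf.1).trans_lt
    (ENNReal.mul_lt_top hj.2 hf.2)⟩

theorem ae_integrable_conv {j f : Pt d → ℂ} (hj : Integrable j) (hf : MemLp f 2 volume) :
    ∀ᵐ x, Integrable (fun y => j (x - y) * f y) := by
  have hfin : ∫⁻ x, (∫⁻ y, ‖j (x - y) * f y‖ₑ) ^ 2 ≠ ∞ := by
    refine ((enorm_convFun_sq_lintegral_le hj hf.1).trans_lt
      (ENNReal.mul_lt_top (ENNReal.pow_lt_top hj.2) ?_)).ne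
    rw [← eLpNorm_two_sq]
    exact ENNReal.pow_lt_top hf.2
  have h : AEStronglyMeasurable (fun p : Pt d × Pt d => j (p.1 - p.2) * f p.2)
      (volume.prod volume) :=
    (hj.1.comp_quasiMeasurePreserving (quasiMeasurePreserving_sub volume volume)).mul hf.1.comp_snd
  have hm : AEMeasurable (fun x => (∫⁻ y, ‖j (x - y) * f y‖ₑ) ^ 2) volume :=
    (h.enorm.lintegral_prod_right').pow_const 2
  filter_upwards [ae_lt_top' hm hfin, h.prodMk_left] with x hx hxm
  refine ⟨hxm, ?_⟩
  by_contra hcon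
  rw [hasFiniteIntegral_iff_enorm, not_lt, top_le_iff] at hcon
  rw [hcon] at hx
  simp at hx

/-- The bounded integral operator `J` on `L²(ℝ^d)` with kernel `J(x,y) = j(x - y)`. -/
def integralOp (j : Pt d → ℂ) (hj : Integrable j) : L2 d →L[ℂ] L2 d :=
  LinearMap.mkContinuous
    { toFun := fun f => (memLp_convFun hj (Lp.memLp f)).toLp _
      map_add' := fun f g => by
        refine Lp.ext ?_
        filter_upwards [ae_integrable_conv hj (Lp.memLp f), ae_integrable_conv hj (Lp.memLp g),
          MemLp.coeFn_toLp (memLp_convFun hj (Lp.memLp (f + g))),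
          MemLp.coeFn_toLp (memLp_convFun hj (Lp.memLp f)),
          MemLp.coeFn_toLp (memLp_convFun hj (Lp.memLp g)),
          Lp.coeFn_add ((memLp_convFun hj (Lp.memLp f)).toLp _)
            ((memLp_convFun hj (Lp.memLp g)).toLp _)] with x hf hg h1 h2 h3 h4
        rw [h1, h4, Pi.add_apply, h2, h3]
        unfold convFun
        rw [← integral_add hf hg]
        refine integral_congr_ae ?_
        filter_upwards [Lp.coeFn_add f g] with y hy
        rw [hy, Pi.add_apply, mul_add]
      map_smul' := fun c f => by
        refine Lp.ext ?_
        filter_upwards [MemLp.coeFn_toLp (memLp_convFun hj (Lp.memLp (c • f))),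
          MemLp.coeFn_toLp (memLp_convFun hj (Lp.memLp f)),
          Lp.coeFn_smul c ((memLp_convFun hj (Lp.memLp f)).toLp _)] with x h1 h2 h3
        rw [h1, RingHom.id_apply, h3, Pi.smul_apply, h2]
        unfold convFun
        rw [← integral_smul]
        refine integral_congr_ae ?_
        filter_upwards [Lp.coeFn_smul c f] with y hy
        rw [hy, Pi.smul_apply, smul_eq_mul, smul_eq_mul]
        ring }
    (∫⁻ x, ‖j x‖ₑ).toReal
    (fun f => by
      refine (Lp.norm_toLp _ (memLp_convFun hj (Lp.memLp f))).trans_le ?_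
      rw [Lp.norm_def, ← ENNReal.toReal_mul]
      exact ENNReal.toReal_mono (ENNReal.mul_lt_top hj.2 (Lp.eLpNorm_lt_top f)).ne
        (eLpNorm_convFun_le hj (Lp.aestronglyMeasurable f)))

theorem integralOp_apply (j : Pt d → ℂ) (hj : Integrable j) (f : L2 d) :
    integralOp j hj f =ᵐ[volume] fun x => ∫ y, j (x - y) * f y :=
  MemLp.coeFn_toLp (memLp_convFun hj (Lp.memLp f))

theorem memLp_mask (Λ : Region d) (f : L2 d) :
    MemLp (Λ.1.indicator (f : Pt d → ℂ)) 2 volume :=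
  (Lp.memLp f).indicator Λ.2.1

/-- The projection `P_Λ` of `L²(ℝ^d)` onto `L²(Λ)`, i.e. multiplication by `1_Λ`. -/
def proj (Λ : Region d) : L2 d →L[ℂ] L2 d :=
  LinearMap.mkContinuous
    { toFun := fun f => (memLp_mask Λ f).toLp _
      map_add' := fun f g => by
        refine Lp.ext ?_
        filter_upwards [MemLp.coeFn_toLp (memLp_mask Λ (f + g)),
          MemLp.coeFn_toLp (memLp_mask Λ f),
          MemLp.coeFn_toLp (memLp_mask Λ g), Lp.coeFn_add f g,
          Lp.coeFn_add ((memLp_mask Λ f).toLp _)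
            ((memLp_mask Λ g).toLp _)] with x h1 h2 h3 h4 h5
        rw [h1, h5, Pi.add_apply, h2, h3]
        by_cases h : x ∈ Λ.1
        · rw [indicator_of_mem h, indicator_of_mem h, indicator_of_mem h, h4, Pi.add_apply]
        · rw [indicator_of_notMem h, indicator_of_notMem h, indicator_of_notMem h, add_zero]
      map_smul' := fun c f => by
        refine Lp.ext ?_
        filter_upwards [MemLp.coeFn_toLp (memLp_mask Λ (c • f)),
          MemLp.coeFn_toLp (memLp_mask Λ f), Lp.coeFn_smul c f,
          Lp.coeFn_smul c ((memLp_mask Λ f).toLp _)] with x h1 h2 h3 h4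
        rw [h1, RingHom.id_apply, h4, Pi.smul_apply, h2]
        by_cases h : x ∈ Λ.1
        · rw [indicator_of_mem h, indicator_of_mem h, h3, Pi.smul_apply]
        · rw [indicator_of_notMem h, indicator_of_notMem h, smul_zero] }
    1
    (fun f => by
      refine (Lp.norm_toLp _ (memLp_mask Λ f)).trans_le ?_
      rw [Lp.norm_def, one_mul]
      exact ENNReal.toReal_mono (Lp.eLpNorm_ne_top f) (eLpNorm_indicator_le _))

/-- The restriction `J_Λ = P_Λ J P_Λ`. -/
def restrictedOp (j : Pt d → ℂ) (hj : Integrable j) (Λ : Region d) : L2 d →L[ℂ] L2 d :=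
  proj Λ ∘L integralOp j hj ∘L proj Λ

end

end DetGibbs

open DetGibbs

namespace DetGibbs

noncomputable section

variable {d : ℕ} {j : Pt d → ℂ}

/-! ### Determinants of positive definite kernels -/

section

open scoped ComplexOrder

/-! Everything is expressed through the ratio `ratio j ζ η` = det J(ζη,ζη) / det J(η,η), which
equals exp(-(U(ζ) + W(ζ;η))) by `energy_add_mutualEnergy`. Since `j` is the Fourier transform of a
positive measure, all matrices (j(xᵢ - xₖ)) are positive semidefinite. When det J(η,η) ≠ 0, Schur
complements give log-submodularity of the determinant (`IsAdmissible.gram_cons_cons_mul_le`). Hence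
the ratio decreases when particles are added to η (`IsAdmissible.ratio_anti`). This is the
monotonicity of the energy, so exp(-H_Λ(ζ;ξ)) is the infimum `boltz` of the ratios over an
exhausting sequence of balls.

Comparison with η = ∅ gives exp(-H_Λ) ≤ det J(ζ,ζ), so Z_Λ is at most the Lebesgue–Poisson integral
of the determinant. Hadamard's inequality makes that integral finite, and it is the Fredholm
determinant. To see this, write J_Λ as the superposition ∫ |φ_t⟩⟨φ_t| dμ(t) of plane waves cut off
by Λ (`inner_restrictedOp`). Andréief's identity in t, Cauchy–Binet over the basis and Andréief's
identity in x turn Tr(⋀ⁿ J_Λ) into (1/n!) ∫_{Λⁿ} det j(xᵢ - xₖ) dx for any orthonormal basis. All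
terms are nonnegative, so Tonelli suffices throughout.

Consistency of the kernels is the identity exp(-H_Δ(xy;ξ)) = exp(-H_Λ(x; y ξ_{Δᶜ})) exp(-H_Δ(y;ξ))
for x in Λ and y in Δ ∖ Λ with exp(-H_Δ(y;ξ)) ≠ 0 (`boltz_add`), combined with the factorization of
Lebesgue–Poisson integrals over Λ and Δ ∖ Λ (`poissonInt_split`). The identity is a chain rule for
ratios, except that the boundary particles of Λ may be fewer than those used for Δ. The superfluous
ones have distance at least R from Λ and from the boundary particles of Λ, so the matrix splits into
blocks and their determinant cancels (`gram_add_bdryPts`).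

Measurability rests on sums over the particles of a configuration (`MeasurablePts.measurable_sum`).
Determinants are recovered from such sums by symmetrization, so no measurable enumeration of the
particles is needed. -/

open Classical in
theorem exists_equiv_of_map_univ_eq {α β γ : Type*} [Fintype α] [Fintype β] {f : α → γ} {g : β → γ}
    (h : (Finset.univ : Finset α).val.map f = (Finset.univ : Finset β).val.map g) :
    ∃ e : α ≃ β, ∀ a, g (e a) = f a := by
  have hc : ∀ c, Nonempty ({a // f a = c} ≃ {b // g b = c}) := fun c => by
    have := congrArg (Multiset.count c) h
    rw [Multiset.count_map, Multiset.count_map] at this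
    refine ⟨Fintype.equivOfCardEq ?_⟩
    rw [Fintype.card_subtype, Fintype.card_subtype]
    simpa [Finset.card, eq_comm] using this
  exact ⟨Equiv.ofFiberEquiv fun c => (hc c).some, fun a => Equiv.ofFiberEquiv_map _ a⟩

/-- A simultaneous relabelling of rows and columns preserves the determinant. This allows tuples
(indexed by `Fin n`) and unions (indexed by sum types, hence block matrices). -/
theorem gramDet_eq (j : Pt d → ℂ) {ι : Type*} [Fintype ι] [DecidableEq ι] {f : ι → Pt d}
    {s : Multiset (Pt d)} (h : (Finset.univ : Finset ι).val.map f = s) :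
    gramDet j s = Matrix.det (Matrix.of fun a b => j (f a - f b)) := by
  classical
  obtain ⟨e, he⟩ := exists_equiv_of_map_univ_eq (g := fun x : s.ToType => x.1)
    (h.trans (by convert (Multiset.map_univ_coe s).symm))
  rw [gramDet, ← Matrix.det_submatrix_equiv_self e]
  congr 1
  · ext a b
    simp [← he]

theorem gramDet_tuplePts (j : Pt d → ℂ) {n : ℕ} (x : Fin n → Pt d) :
    gramDet j (tuplePts x) = Matrix.det (Matrix.of fun a b => j (x a - x b)) :=
  gramDet_eq j rfl

theorem map_univ_sum_elim {α β γ : Type*} [Fintype α] [Fintype β] (f : α → γ) (g : β → γ) :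
    (Finset.univ : Finset (α ⊕ β)).val.map (Sum.elim f g) =
      (Finset.univ : Finset α).val.map f + (Finset.univ : Finset β).val.map g := by
  simp [← Finset.univ_disjSum_univ, Finset.disjSum, Multiset.disjSum, Multiset.map_map]

open Classical in
theorem map_univ_toType (s : Multiset (Pt d)) :
    (Finset.univ : Finset s.ToType).val.map (fun x => x.1) = s := Multiset.map_univ_coe s

theorem gramDet_zero : gramDet j 0 = 1 := by
  rw [gramDet_eq j (f := (Fin.elim0 : Fin 0 → Pt d)) (by simp)]
  simp

/-- One vanishing off-diagonal block already makes the matrix block triangular. -/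
theorem gramDet_add_of_cross_zero {s t : Multiset (Pt d)}
    (h : ∀ x ∈ s, ∀ y ∈ t, j (y - x) = 0) : gramDet j (s + t) = gramDet j s * gramDet j t := by
  classical
  rw [gramDet_eq j (f := Sum.elim (fun x : s.ToType => x.1) (fun x : t.ToType => x.1))
      (by rw [map_univ_sum_elim, map_univ_toType, map_univ_toType])]
  rw [gramDet, gramDet, ← Matrix.det_fromBlocks_zero₂₁ _
    (Matrix.of fun (a : s.ToType) (b : t.ToType) => j (a.1 - b.1)) _]
  congr 1
  ext a b
  rcases a with a | a <;> rcases b with b | b <;> simp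
  exact h _ (Multiset.coe_mem) _ (Multiset.coe_mem)

/-- A repeated point produces two equal rows. -/
theorem gramDet_eq_zero_of_not_nodup {s : Multiset (Pt d)} (h : ¬ s.Nodup) : gramDet j s = 0 := by
  classical
  rw [Multiset.nodup_iff_count_le_one] at h
  push Not at h
  obtain ⟨x, hx⟩ := h
  rw [gramDet]
  refine Matrix.det_zero_of_row_eq (i := ⟨x, ⟨0, ?_⟩⟩) (j := ⟨x, ⟨1, ?_⟩⟩) ?_ rfl
  · convert (zero_lt_one.trans hx)
  · convert hx
  · intro hh
    exact zero_ne_one (Fin.mk.inj (eq_of_heq (Sigma.mk.inj hh).2))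

/-- The spectral measure `(2π)⁻ᵈ ρ` of an admissible kernel. -/
theorem IsAdmissible.exists_measure (hj : IsAdmissible j) : ∃ μ : Measure (Pt d),
    IsFiniteMeasure μ ∧ ∀ x, j x = ∫ t, Complex.exp (Complex.I * ((inner ℝ x t : ℝ) : ℂ)) ∂μ := by
  obtain ⟨ρ, hρ, h⟩ := hj.fourier
  refine ⟨ENNReal.ofReal (((2 * Real.pi) ^ d)⁻¹) • ρ, ρ.smul_finite ENNReal.ofReal_ne_top,
    fun x => ?_⟩
  rw [integral_smul_measure, h, ENNReal.toReal_ofReal (by positivity)]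
  rfl

/-- The character `x ↦ exp(i x·t)`. -/
def character (t x : Pt d) : ℂ := Complex.exp (Complex.I * ((inner ℝ x t : ℝ) : ℂ))

theorem continuous_character : Continuous fun p : Pt d × Pt d => character p.1 p.2 := by
  unfold character; fun_prop

@[simp] theorem norm_character (t x : Pt d) : ‖character t x‖ = 1 := by
  rw [character, mul_comm, Complex.norm_exp_ofReal_mul_I]

theorem character_sub (t x y : Pt d) :
    character t (x - y) = character t x * star (character t y) := by
  simp only [character, inner_sub_left, RCLike.star_def, ← Complex.exp_conj, ← Complex.exp_add]
  congr 1
  simp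
  ring

theorem integrable_character (μ : Measure (Pt d)) [IsFiniteMeasure μ] (x : Pt d) :
    Integrable (fun t => character t x) μ := by
  refine (integrable_const (1 : ℝ)).mono' ?_ (by simp)
  exact (continuous_character.comp (by fun_prop : Continuous fun t : Pt d => (t, x))).aestronglyMeasurable

theorem IsAdmissible.continuous (hj : IsAdmissible j) : Continuous j := by
  obtain ⟨μ, hμ, h⟩ := hj.exists_measure
  have : j = fun x => ∫ t, character t x ∂μ := funext h
  rw [this]
  refine continuous_of_dominated (bound := fun _ => 1)
    (fun x => (integrable_character μ x).1) (by simp) (integrable_const _) ?_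
  refine Eventually.of_forall fun t => ?_
  exact continuous_character.comp (by fun_prop : Continuous fun x : Pt d => (t, x))

/-- The quadratic form at z is ∫ |∑ₐ z̄ₐ exp(i xₐ·t)|² dμ(t). -/
theorem IsAdmissible.posSemidef (hj : IsAdmissible j) {ι : Type*} [Fintype ι] (x : ι → Pt d) :
    (Matrix.of fun a b => j (x a - x b)).PosSemidef := by
  obtain ⟨μ, hμ, h⟩ := hj.exists_measure
  have hint : ∀ a b, Integrable (fun t => character t (x a) * star (character t (x b))) μ :=
    fun a b => by simpa only [character_sub] using integrable_character μ (x a - x b)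
  have hj' : ∀ a b, j (x a - x b) = ∫ t, character t (x a) * star (character t (x b)) ∂μ :=
    fun a b => by rw [h]; exact integral_congr_ae (Eventually.of_forall fun t => character_sub t _ _)
  refine Matrix.PosSemidef.of_dotProduct_mulVec_nonneg ?_ fun z => ?_
  · ext a b
    rw [Matrix.conjTranspose_apply, Matrix.of_apply, Matrix.of_apply, hj', hj', RCLike.star_def,
      ← integral_conj]
    congr 1
    ext t
    simp [mul_comm]
  · have : star z ⬝ᵥ (Matrix.of fun a b => j (x a - x b)).mulVec z =
        ∫ t, ((Complex.normSq (∑ a, star (z a) * character t (x a)) : ℝ) : ℂ) ∂μ := by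
      have e : ∀ t, ((Complex.normSq (∑ a, star (z a) * character t (x a)) : ℝ) : ℂ) =
          ∑ a, ∑ b, star (z a) * z b * (character t (x a) * star (character t (x b))) := by
        intro t
        rw [Complex.normSq_eq_conj_mul_self, mul_comm, map_sum, Finset.sum_mul_sum]
        refine Finset.sum_congr rfl fun a _ => Finset.sum_congr rfl fun b _ => ?_
        simp
        ring
      simp_rw [e]
      rw [integral_finsetSum _ fun a _ => integrable_finsetSum _ fun b _ => (hint a b).const_mul _]
      simp only [dotProduct, Matrix.mulVec, Pi.star_apply, Matrix.of_apply, Finset.mul_sum]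
      refine Finset.sum_congr rfl fun a _ => ?_
      rw [integral_finsetSum _ fun b _ => (hint a b).const_mul _]
      refine Finset.sum_congr rfl fun b _ => ?_
      rw [integral_const_mul, hj']
      ring
    rw [this, integral_complex_ofReal]
    rw [Complex.zero_le_real]
    exact integral_nonneg fun t => Complex.normSq_nonneg _

theorem IsAdmissible.gramDet_nonneg (hj : IsAdmissible j) (s : Multiset (Pt d)) :
    0 ≤ gramDet j s := by
  classical
  exact (hj.posSemidef (fun x : s.ToType => x.1)).det_nonneg

/-- The determinant `det (j(xᵢ - xₖ))` as an extended nonnegative number. -/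
def gram (j : Pt d → ℂ) (s : Multiset (Pt d)) : ℝ≥0∞ := ENNReal.ofReal (gramDet j s).re

theorem gram_ne_top (s : Multiset (Pt d)) : gram j s ≠ ∞ := ENNReal.ofReal_ne_top

@[simp] theorem gram_zero : gram j 0 = 1 := by simp [gram, gramDet_zero]

theorem IsAdmissible.gram_eq_zero (hj : IsAdmissible j) (s : Multiset (Pt d)) :
    gram j s = 0 ↔ gramDet j s = 0 := by
  have h := Complex.nonneg_iff.1 (hj.gramDet_nonneg s)
  rw [gram, ENNReal.ofReal_eq_zero]
  constructor
  · intro h'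
    exact Complex.ext (le_antisymm h' h.1) h.2.symm
  · intro h'; rw [h']; simp

theorem gram_eq_zero_of_not_nodup {s : Multiset (Pt d)} (h : ¬ s.Nodup) : gram j s = 0 := by
  simp [gram, gramDet_eq_zero_of_not_nodup h]

theorem IsAdmissible.gram_add_of_cross_zero (hj : IsAdmissible j) {s t : Multiset (Pt d)}
    (h : ∀ x ∈ s, ∀ y ∈ t, j (y - x) = 0) : gram j (s + t) = gram j s * gram j t := by
  have h1 := Complex.nonneg_iff.1 (hj.gramDet_nonneg s)
  have h2 := Complex.nonneg_iff.1 (hj.gramDet_nonneg t)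
  rw [gram, gram, gram, gramDet_add_of_cross_zero h, ← ENNReal.ofReal_mul h1.1, Complex.mul_re,
    ← h1.2, zero_mul, sub_zero]

/-- A nondegenerate positive semidefinite matrix is positive definite, and so are its principal
submatrices. -/
theorem IsAdmissible.gram_ne_zero_of_le (hj : IsAdmissible j) {s t : Multiset (Pt d)} (hst : s ≤ t)
    (h : gram j t ≠ 0) : gram j s ≠ 0 := by
  classical
  obtain ⟨u, rfl⟩ := Multiset.le_iff_exists_add.1 hst
  rw [Ne, hj.gram_eq_zero] at h ⊢
  rw [gramDet_eq j (f := Sum.elim (fun x : s.ToType => x.1) (fun x : u.ToType => x.1))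
      (by rw [map_univ_sum_elim, map_univ_toType, map_univ_toType])] at h
  have h1 := ((hj.posSemidef _).posDef_iff_det_ne_zero.2 h).submatrix
    (e := (Sum.inl : s.ToType → s.ToType ⊕ u.ToType)) Sum.inl_injective
  exact (h1.det_pos).ne'

/-- The Desnanot–Jacobi (log-submodularity) inequality for Gram determinants. -/
theorem IsAdmissible.gram_cons_cons_mul_le (hj : IsAdmissible j) (x y : Pt d)
    {s : Multiset (Pt d)} (hs : gram j s ≠ 0) :
    gram j (x ::ₘ y ::ₘ s) * gram j s ≤ gram j (x ::ₘ s) * gram j (y ::ₘ s) := by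
  classical
  rw [Ne, hj.gram_eq_zero] at hs
  set A : Matrix s.ToType s.ToType ℂ := Matrix.of fun a b => j (a.1 - b.1) with hA
  have hAdet : gramDet j s = A.det := rfl
  rw [hAdet] at hs
  have hAh : A.IsHermitian := (hj.posSemidef (fun x : s.ToType => x.1)).1
  let _ : Invertible A := Matrix.invertibleOfIsUnitDet _ (isUnit_iff_ne_zero.2 hs)
  -- the Schur complement
  set S : Pt d → Pt d → ℂ := fun u v =>
    j (u - v) - ∑ b, (∑ a, j (u - a.1) * A⁻¹ a b) * j (b.1 - v) with hS
  have hconj : ∀ u v, star (j (u - v)) = j (v - u) := fun u v => by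
    have := (hj.posSemidef ![u, v]).1.apply 1 0
    simpa using this
  have hSh : ∀ u v, star (S u v) = S v u := fun u v => by
    simp only [hS, star_sub, star_sum, star_mul', hconj]
    congr 1
    simp_rw [Finset.sum_mul]
    rw [Finset.sum_comm]
    refine Finset.sum_congr rfl fun a _ => Finset.sum_congr rfl fun b _ => ?_
    rw [hAh.inv.apply]
    ring
  -- Adjoining points to `s` multiplies the determinant by that of the Schur complement, so one or
  -- two extra points only involve the entries of `S`.
  have key : ∀ {ι : Type} [Fintype ι] [DecidableEq ι] (f : ι → Pt d),
      gramDet j (s + Finset.univ.val.map f) = A.det * (Matrix.of fun a b => S (f a) (f b)).det := by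
    intro ι _ _ f
    rw [gramDet_eq j (f := Sum.elim (fun x : s.ToType => x.1) f)
      (by rw [map_univ_sum_elim, map_univ_toType])]
    have : (Matrix.of fun a b => j (Sum.elim (fun x : s.ToType => x.1) f a -
        Sum.elim (fun x : s.ToType => x.1) f b)) = Matrix.fromBlocks A
          (Matrix.of fun a b => j (a.1 - f b)) (Matrix.of fun a b => j (f a - b.1))
          (Matrix.of fun a b => j (f a - f b)) := by
      ext a b
      rcases a with a | a <;> rcases b with b | b <;> simp [hA]
    rw [this, Matrix.det_fromBlocks₁₁]
    congr 2
  have k1 : ∀ u, gramDet j (u ::ₘ s) = A.det * S u u := fun u => by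
    have := key (fun _ : Unit => u)
    simpa [add_comm s] using this
  have k2 : gramDet j (x ::ₘ y ::ₘ s) = A.det * (S x x * S y y - S x y * S y x) := by
    have := key ![x, y]
    rw [Matrix.det_fin_two] at this
    have e : (Finset.univ : Finset (Fin 2)).val.map ![x, y] = {x} + {y} := by rfl
    rw [e, add_comm s, add_assoc, Multiset.singleton_add, Multiset.singleton_add] at this
    simpa using this
  have hnn := fun t => Complex.nonneg_iff.1 (hj.gramDet_nonneg t)
  rw [gram, gram, gram, gram, ← ENNReal.ofReal_mul (hnn _).1, ← ENNReal.ofReal_mul (hnn _).1]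
  refine ENNReal.ofReal_le_ofReal ?_
  -- As `S` is Hermitian, the two sides of the inequality differ by det(A)² |S(x,y)|².
  have hid : gramDet j (x ::ₘ s) * gramDet j (y ::ₘ s) = gramDet j (x ::ₘ y ::ₘ s) * gramDet j s +
      gramDet j s * gramDet j s * (Complex.normSq (S x y) : ℂ) := by
    rw [k1, k1, k2, hAdet, Complex.normSq_eq_conj_mul_self]
    have := hSh x y
    rw [RCLike.star_def] at this
    rw [this]
    ring
  have hre := congrArg Complex.re hid
  simp only [Complex.mul_re, Complex.add_re, ← (hnn _).2, Complex.ofReal_re, Complex.ofReal_im,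
    mul_zero, sub_zero] at hre
  have := mul_nonneg (mul_self_nonneg (gramDet j s).re) (Complex.normSq_nonneg (S x y))
  linarith

/-- The ratio `det J(ζη, ζη) / det J(η, η)`. -/
def ratio (j : Pt d → ℂ) (ζ η : Multiset (Pt d)) : ℝ≥0∞ := gram j (ζ + η) / gram j η

theorem ratio_ne_top {ζ η : Multiset (Pt d)} (h : gram j η ≠ 0) : ratio j ζ η ≠ ∞ :=
  ENNReal.div_ne_top (gram_ne_top _) h

/-- The chain rule for conditional intensities: insert α first, then ζ. -/
theorem ratio_mul {ζ α η : Multiset (Pt d)} (h : gram j (α + η) ≠ 0) :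
    ratio j ζ (α + η) * ratio j α η = ratio j (ζ + α) η := by
  rw [ratio, ratio, ratio, ← mul_div_assoc, ENNReal.div_mul_cancel h (gram_ne_top _), add_assoc]

/-- The particles of η' are adjoined one at a time, each step being the log-submodularity
inequality. -/
theorem IsAdmissible.ratio_singleton_anti (hj : IsAdmissible j) (x : Pt d)
    {η η' : Multiset (Pt d)} (h : gram j (η' + η) ≠ 0) :
    ratio j {x} (η' + η) ≤ ratio j {x} η := by
  induction η' using Multiset.induction with
  | empty => simp
  | cons y t ih =>
    have h1 : gram j (t + η) ≠ 0 := hj.gram_ne_zero_of_le (by gcongr; exact Multiset.le_cons_self _ _) h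
    refine le_trans ?_ (ih h1)
    rw [ratio, ratio, ENNReal.div_le_iff h (gram_ne_top _), ENNReal.mul_comm_div,
      ← mul_div_assoc, ENNReal.le_div_iff_mul_le (Or.inl h1) (Or.inl (gram_ne_top _))]
    have := hj.gram_cons_cons_mul_le x y h1
    rw [Multiset.cons_swap] at this
    simpa using this

/-- The points of ζ are peeled off with the chain rule, which reduces to a single point. If the
remaining points are already degenerate together with the larger environment, the left side is zero.
-/
theorem IsAdmissible.ratio_anti (hj : IsAdmissible j) (ζ : Multiset (Pt d))
    {η η' : Multiset (Pt d)} (hle : η ≤ η') (h : gram j η' ≠ 0) :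
    ratio j ζ η' ≤ ratio j ζ η := by
  obtain ⟨u, rfl⟩ := Multiset.le_iff_exists_add.1 hle
  rw [add_comm η] at h ⊢
  have h' : gram j η ≠ 0 := hj.gram_ne_zero_of_le hle (by rwa [add_comm])
  induction ζ using Multiset.induction with
  | empty =>
    rw [ratio, ratio, zero_add, zero_add, ENNReal.div_self h (gram_ne_top _),
      ENNReal.div_self h' (gram_ne_top _)]
  | cons x t ih =>
    rw [← Multiset.singleton_add]
    by_cases h0 : gram j (t + (u + η)) = 0
    · have : gram j ({x} + t + (u + η)) = 0 := by
        by_contra hc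
        refine hj.gram_ne_zero_of_le ?_ hc h0
        rw [add_assoc]
        exact Multiset.le_add_left _ _
      rw [ratio, this, ENNReal.zero_div]
      exact bot_le
    · have h1 : gram j (t + η) ≠ 0 := hj.gram_ne_zero_of_le (by gcongr; simp) h0
      rw [← ratio_mul h0, ← ratio_mul h1]
      refine mul_le_mul' ?_ ih
      have e : t + (u + η) = u + (t + η) := by abel
      rw [e] at h0 ⊢
      exact hj.ratio_singleton_anti x h0

theorem IsAdmissible.ratio_le_gram (hj : IsAdmissible j) (ζ : Multiset (Pt d))
    {η : Multiset (Pt d)} (h : gram j η ≠ 0) : ratio j ζ η ≤ gram j ζ := by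
  have := hj.ratio_anti ζ (Multiset.zero_le η) h
  simpa [ratio] using this

/-- Hadamard's inequality. -/
theorem IsAdmissible.gram_le_pow (hj : IsAdmissible j) (s : Multiset (Pt d)) :
    gram j s ≤ ENNReal.ofReal (j 0).re ^ s.card := by
  induction s using Multiset.induction with
  | empty => simp
  | cons x t ih =>
    by_cases h0 : gram j t = 0
    · have : gram j (x ::ₘ t) = 0 := by
        by_contra hc
        exact hj.gram_ne_zero_of_le (Multiset.le_cons_self _ _) hc h0
      rw [this]
      exact bot_le
    · have h1 := hj.ratio_le_gram {x} h0
      rw [ratio, ENNReal.div_le_iff h0 (gram_ne_top _), Multiset.singleton_add] at h1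
      have h2 : gram j {x} = ENNReal.ofReal (j 0).re := by
        rw [gram, gramDet_eq j (f := fun _ : Unit => x) (by simp)]
        simp
      rw [Multiset.card_cons, pow_succ', ← h2]
      exact h1.trans (by rw [h2]; gcongr)

end

/-! ### Configurations in bounded sets -/

namespace Config

open Classical in
theorem count_pts (ξ : Config d) {D : Set (Pt d)} (hD : Bornology.IsBounded D) (x : Pt d) :
    (ξ.pts D).count x = if x ∈ D then ξ.mult x else 0 := by
  have e : ξ.pts D = ∑ y ∈ (ξ.locallyFinite D hD).toFinset,
      Multiset.replicate (ξ.mult y) y := by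
    rw [pts]
    refine finsum_mem_eq_sum_of_inter_support_eq _ ?_
    ext y
    simp only [mem_inter_iff, Function.mem_support, Finite.coe_toFinset, mem_ofPred_eq, ne_eq,
      ← Multiset.card_eq_zero, Multiset.card_replicate]
    tauto
  rw [e, Multiset.count_sum']
  simp only [Multiset.count_replicate]
  rw [Finset.sum_ite_eq']
  simp only [Finite.mem_toFinset, mem_ofPred_eq]
  split_ifs <;> grind

theorem mem_pts {ξ : Config d} {D : Set (Pt d)} (hD : Bornology.IsBounded D) {x : Pt d} :
    x ∈ ξ.pts D ↔ x ∈ D ∧ ξ.mult x ≠ 0 := by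
  classical
  rw [← Multiset.count_ne_zero, ξ.count_pts hD]
  split_ifs <;> simp_all

theorem count_eq_card (ξ : Config d) {D : Set (Pt d)} (hD : Bornology.IsBounded D) :
    ξ.count D = (ξ.pts D).card := by
  classical
  have hsub : (ξ.pts D).toFinset ⊆ (ξ.locallyFinite D hD).toFinset := fun x hx => by
    simpa [mem_pts hD] using hx
  rw [count, ← Multiset.sum_count_eq_card (s := (ξ.locallyFinite D hD).toFinset)
    fun x hx => hsub (Multiset.mem_toFinset.2 hx)]
  rw [finsum_mem_eq_sum_of_inter_support_eq (t := (ξ.locallyFinite D hD).toFinset)]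
  · refine Finset.sum_congr rfl fun x hx => ?_
    rw [ξ.count_pts hD, if_pos (by simp at hx; exact hx.1)]
  · ext x
    simp only [mem_inter_iff, Function.mem_support, Finite.coe_toFinset, mem_ofPred_eq]
    tauto

open Classical in
theorem filter_pts (ξ : Config d) {D : Set (Pt d)} (hD : Bornology.IsBounded D) (A : Set (Pt d)) :
    (ξ.pts D).filter (· ∈ A) = ξ.pts (D ∩ A) := by
  ext x
  rw [Multiset.count_filter, ξ.count_pts hD, ξ.count_pts (hD.subset inter_subset_left)]
  split_ifs <;> simp_all

open Classical in
theorem pts_restrict (ξ : Config d) {D : Set (Pt d)} (hD : Bornology.IsBounded D) (A : Set (Pt d)) :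
    (ξ.restrict A).pts D = ξ.pts (D ∩ A) := by
  ext x
  rw [(ξ.restrict A).count_pts hD, ξ.count_pts (hD.subset inter_subset_left)]
  simp only [restrict]
  split_ifs <;> simp_all

theorem pts_mono (ξ : Config d) {D D' : Set (Pt d)} (hD' : Bornology.IsBounded D') (h : D ⊆ D') :
    ξ.pts D ≤ ξ.pts D' := by
  classical
  rw [← inter_eq_self_of_subset_right h, ← ξ.filter_pts hD']
  exact Multiset.filter_le _ _

open Classical in
theorem pts_glue (Λ : Set (Pt d)) (ζ : Multiset (Pt d)) (ξ : Config d) {D : Set (Pt d)}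
    (hD : Bornology.IsBounded D) :
    (glue Λ ζ ξ).pts D = ζ.filter (· ∈ D) + ξ.pts (D \ Λ) := by
  ext x
  rw [(glue Λ ζ ξ).count_pts hD, Multiset.count_add, Multiset.count_filter,
    ξ.count_pts (hD.subset sdiff_subset)]
  simp only [glue, restrict]
  split_ifs <;> simp_all

theorem restrict_glue {Λ : Set (Pt d)} {ζ : Multiset (Pt d)} (h : ∀ x ∈ ζ, x ∈ Λ) (ξ : Config d) :
    (glue Λ ζ ξ).restrict Λᶜ = ξ.restrict Λᶜ := by
  classical
  ext x
  simp only [glue, restrict]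
  split_ifs with hx
  · rw [Multiset.count_eq_zero_of_notMem fun hc => hx (h x hc), zero_add]
  · rfl

/-- The points of y must avoid Λ, since gluing inside Λ erases whatever was there. -/
theorem glue_glue {Λ Δ : Set (Pt d)} (hΛ : Λ ⊆ Δ) {y : Multiset (Pt d)}
    (hy : ∀ p ∈ y, p ∈ Δ \ Λ) (x : Multiset (Pt d)) (ξ : Config d) :
    glue Λ x (glue Δ y ξ) = glue Δ (x + y) ξ := by
  classical
  ext p
  simp only [glue, restrict, Multiset.count_add]
  by_cases h1 : p ∈ Λ
  · have : y.count p = 0 := Multiset.count_eq_zero_of_notMem fun hc => (hy p hc).2 h1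
    simp [h1, this, hΛ h1]
  · simp [h1, add_assoc]

end Config

/-! ### The interacting boundary particles -/

/-- The points at distance `< R` from the end of a chain of `k` particles of `ξ` outside `Λ` that
starts in `Λ`. -/
def reach (j : Pt d → ℂ) (Λ : Set (Pt d)) (ξ : Config d) : ℕ → Set (Pt d)
  | 0 => {x | ∃ p ∈ Λ, ((dist x p : ℝ) : EReal) < interactionRange j}
  | k + 1 => {x | ∃ y, (y ∈ Λᶜ ∧ ξ.mult y ≠ 0) ∧ y ∈ reach j Λ ξ k ∧
      ((dist x y : ℝ) : EReal) < interactionRange j}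

/-- The region that interacts with `Λ` through the particles of `ξ`. -/
def nbhd (j : Pt d → ℂ) (Λ : Set (Pt d)) (ξ : Config d) : Set (Pt d) :=
  {x | interactionRange j = ⊤ ∨ ∃ k, x ∈ reach j Λ ξ k}

/-- The index counts intermediate particles, so a chain in `reach j Λ ξ k` has k + 1 steps, and its
endpoint need not be a particle. The region is thus defined for all points of space and can be
studied jointly in (ξ, x). -/
theorem mem_reach_iff {Λ : Set (Pt d)} {ξ : Config d} {k : ℕ} {x : Pt d} :
    x ∈ reach j Λ ξ k ↔ ∃ p : ℕ → Pt d, p 0 ∈ Λ ∧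
      (∀ l, 1 ≤ l → l ≤ k → p l ∈ Λᶜ ∧ ξ.mult (p l) ≠ 0) ∧ p (k + 1) = x ∧
      ∀ l < k + 1, ((dist (p (l + 1)) (p l) : ℝ) : EReal) < interactionRange j := by
  induction k generalizing x with
  | zero =>
    constructor
    · rintro ⟨p, hp, h⟩
      refine ⟨fun n => if n = 0 then p else x, by simpa, fun l h1 h2 => by lia, by simp, ?_⟩
      intro l hl
      obtain rfl : l = 0 := by lia
      simpa
    · rintro ⟨p, hp, -, rfl, h⟩
      exact ⟨p 0, hp, h 0 (by lia)⟩
  | succ k ih =>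
    constructor
    · rintro ⟨y, hy, hyk, hd⟩
      obtain ⟨p, hp, h1, h2, h3⟩ := ih.1 hyk
      refine ⟨fun n => if n ≤ k + 1 then p n else x, by simpa, fun l hl1 hl2 => ?_, by simp,
        fun l hl => ?_⟩
      · simp only [hl2, if_true]
        rcases hl2.lt_or_eq with h | rfl
        · exact h1 l hl1 (by lia)
        · rwa [h2]
      · rcases (Nat.lt_succ_iff.1 hl).lt_or_eq with h | rfl
        · simpa [h.le, Nat.succ_le_of_lt h] using h3 l h
        · simpa [h2] using hd
    · rintro ⟨p, hp, h1, rfl, h3⟩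
      exact ⟨p (k + 1), h1 _ (by lia) le_rfl,
        ih.2 ⟨p, hp, fun l ha hb => h1 l ha (by lia), rfl, fun l hl => h3 l (by lia)⟩,
        h3 _ (by lia)⟩

theorem interacts_iff {Λ : Set (Pt d)} {ξ : Config d} {x : Pt d} :
    Interacts j Λ ξ x ↔ (x ∈ Λᶜ ∧ ξ.mult x ≠ 0) ∧ ∃ k, x ∈ reach j Λ ξ k := by
  constructor
  · rintro ⟨k, p, hk, hp, h1, rfl, h3⟩
    obtain ⟨k, rfl⟩ := Nat.exists_eq_add_of_le' hk
    exact ⟨h1 _ hk le_rfl, k, mem_reach_iff.2 ⟨p, hp, fun l ha hb => h1 l ha (by lia), rfl, h3⟩⟩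
  · rintro ⟨hx, k, hk⟩
    obtain ⟨p, hp, h1, h2, h3⟩ := mem_reach_iff.1 hk
    refine ⟨k + 1, p, by lia, hp, fun l ha hb => ?_, h2, h3⟩
    rcases hb.lt_or_eq with h | rfl
    · exact h1 l ha (by lia)
    · rwa [h2]

-- Treats finite and infinite range at once: `nbhd` is the whole space when R = ∞.
open Classical in
theorem mult_boundary (j : Pt d → ℂ) (Λ : Set (Pt d)) (ξ : Config d) (x : Pt d) :
    (boundary j Λ ξ).mult x = if x ∈ Λᶜ ∩ nbhd j Λ ξ then ξ.mult x else 0 := by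
  rw [boundary]
  by_cases h : interactionRange j = ⊤
  · simp [h, Config.restrict, nbhd]
  · simp only [h, if_false, Config.restrict, nbhd, mem_ofPred_eq, interacts_iff, mem_inter_iff,
      false_or]
    split_ifs <;> grind

open Classical in
theorem pts_boundary (j : Pt d → ℂ) (Λ : Set (Pt d)) (ξ : Config d) {D : Set (Pt d)}
    (hD : Bornology.IsBounded D) :
    (boundary j Λ ξ).pts D = (ξ.pts (D \ Λ)).filter (· ∈ nbhd j Λ ξ) := by
  ext x
  rw [Config.count_pts _ hD, Multiset.count_filter, Config.count_pts _ (hD.subset sdiff_subset),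
    mult_boundary]
  by_cases h1 : x ∈ D <;> by_cases h2 : x ∈ Λ <;> by_cases h3 : x ∈ nbhd j Λ ξ <;> simp [h1, h2, h3]

/-! ### The Hamiltonian -/

/-- The closed ball of radius `n` about the origin. -/
def ballRegion (d n : ℕ) : Region d :=
  ⟨Metric.closedBall 0 n, Metric.isClosed_closedBall.measurableSet, Metric.isBounded_closedBall⟩

theorem ballRegion_mono : Monotone (ballRegion d) := fun m n h =>
  Metric.closedBall_subset_closedBall (by exact_mod_cast h)

theorem exists_subset_ballRegion {D : Set (Pt d)} (hD : Bornology.IsBounded D) :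
    ∃ n, D ⊆ (ballRegion d n).1 := by
  obtain ⟨r, hr⟩ := hD.subset_closedBall 0
  obtain ⟨n, hn⟩ := exists_nat_ge r
  exact ⟨n, hr.trans (Metric.closedBall_subset_closedBall hn)⟩

/-- The boundary particles in a bounded set. -/
def bdryPts (j : Pt d → ℂ) (Λ : Region d) (ξ : Config d) (n : ℕ) : Multiset (Pt d) :=
  (boundary j Λ.1 ξ).pts ((ballRegion d n).1 \ Λ.1)

theorem isBounded_diff (Λ Δ : Region d) : Bornology.IsBounded (Δ.1 \ Λ.1) :=
  Δ.2.2.subset sdiff_subset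

theorem bdryPts_mono (Λ : Region d) (ξ : Config d) : Monotone (bdryPts j Λ ξ) := fun _ _ h =>
  Config.pts_mono _ (isBounded_diff _ _) (sdiff_subset_sdiff_left (ballRegion_mono h))

/-- Nondegeneracy passes to subcollections and balls are cofinal, so countably many conditions
suffice. -/
theorem IsAdmissible.mem_possible_iff (hj : IsAdmissible j) {Λ : Region d} {ξ : Config d} :
    ξ ∈ possible j Λ ↔ ∀ n, gram j (bdryPts j Λ ξ n) ≠ 0 := by
  simp only [possible, mem_ofPred_eq, ne_eq, hj.gram_eq_zero]
  constructor
  · intro h n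
    exact h ⟨_, (ballRegion d n).2.1.diff Λ.2.1, isBounded_diff _ _⟩ (sdiff_subset_compl _ _)
  · intro h Δ hΔ
    obtain ⟨n, hn⟩ := exists_subset_ballRegion Δ.2.2
    rw [← hj.gram_eq_zero]
    refine hj.gram_ne_zero_of_le (Config.pts_mono _ (isBounded_diff _ (ballRegion d n)) ?_)
      (mt (hj.gram_eq_zero _).1 (h n))
    exact fun x hx => ⟨hn hx, hΔ hx⟩

theorem IsAdmissible.gram_diff_ne_zero (hj : IsAdmissible j) {Λ : Region d} {ξ : Config d}
    (h : ξ ∈ possible j Λ) (Δ : Region d) : gram j ((boundary j Λ.1 ξ).pts (Δ.1 \ Λ.1)) ≠ 0 :=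
  mt (hj.gram_eq_zero _).1
    (h ⟨_, Δ.2.1.diff Λ.2.1, isBounded_diff _ _⟩ (sdiff_subset_compl _ _))

theorem energy_add_mutualEnergy (hj : IsAdmissible j) (ζ : Multiset (Pt d)) {η : Multiset (Pt d)}
    (h : gram j η ≠ 0) : energy j ζ + mutualEnergy j ζ η = -ENNReal.log (ratio j ζ η) := by
  have hlog : ∀ s, gram j s ≠ 0 → ENNReal.log (gram j s) = (Real.log (gram j s).toReal : ℝ) :=
    fun s hs => ENNReal.log_pos_real hs (gram_ne_top s)
  have hen : ∀ s, energy j s = -ENNReal.log (gram j s) := fun s => rfl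
  rw [mutualEnergy]
  -- In the degenerate case W = +∞, and U(ζ) ≠ -∞ because determinants are finite, so the sum is +∞.
  -- Otherwise all logarithms are real.
  by_cases h0 : gram j (ζ + η) = 0
  · have h1 : energy j (ζ + η) = ⊤ := by rw [hen, h0]; simp
    rw [if_pos h1, ratio, h0, ENNReal.zero_div, ENNReal.log_zero, EReal.neg_bot]
    refine EReal.add_top_of_ne_bot ?_
    rw [hen, Ne, EReal.neg_eq_bot_iff, ENNReal.log_eq_top_iff]
    exact gram_ne_top _
  · have hζ : gram j ζ ≠ 0 := hj.gram_ne_zero_of_le (Multiset.le_add_right _ _) h0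
    have h1 : energy j (ζ + η) ≠ ⊤ := by
      rw [hen, Ne, EReal.neg_eq_top_iff, ENNReal.log_eq_bot_iff]
      exact h0
    have h2 : ratio j ζ η ≠ 0 := ENNReal.div_ne_zero.2 ⟨h0, gram_ne_top _⟩
    rw [if_neg h1, hen, hen, hen, hlog _ h0, hlog _ hζ, hlog _ h,
      ENNReal.log_pos_real h2 (ratio_ne_top h), ratio, ENNReal.toReal_div, Real.log_div
      (ENNReal.toReal_ne_zero.2 ⟨h0, gram_ne_top _⟩) (ENNReal.toReal_ne_zero.2 ⟨h, gram_ne_top _⟩)]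
    norm_cast
    ring

theorem hamOn_eq (hj : IsAdmissible j) {Λ : Region d} (Δ : Region d) (ζ : Multiset (Pt d))
    {ξ : Config d} (h : ξ ∈ possible j Λ) :
    hamOn j Λ Δ ζ ξ = -ENNReal.log (ratio j ζ ((boundary j Λ.1 ξ).pts (Δ.1 \ Λ.1))) :=
  energy_add_mutualEnergy hj ζ (hj.gram_diff_ne_zero h Δ)

theorem monotone_hamOn (hj : IsAdmissible j) {Λ : Region d} (ζ : Multiset (Pt d))
    {ξ : Config d} (h : ξ ∈ possible j Λ) : Monotone fun Δ : Region d => hamOn j Λ Δ ζ ξ := by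
  intro Δ Δ' hΔ
  simp only [hamOn_eq hj _ ζ h]
  rw [EReal.neg_le_neg_iff]
  refine ENNReal.log_monotone (hj.ratio_anti ζ ?_ (hj.gram_diff_ne_zero h Δ'))
  exact Config.pts_mono _ (isBounded_diff _ _) (sdiff_subset_sdiff_left hΔ)

theorem tendsto_hamOn (hj : IsAdmissible j) {Λ : Region d} {ζ : Multiset (Pt d)} {ξ : Config d}
    (hζ : ζ ∈ simpleIn Λ.1) (h : ξ ∈ possible j Λ) :
    Tendsto (fun Δ : Region d => hamOn j Λ Δ ζ ξ) atTop (𝓝 (ham j Λ ζ ξ)) := by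
  rw [ham, if_pos ⟨hζ, h⟩]
  exact tendsto_nhds_limUnder ⟨_, tendsto_atTop_iSup (monotone_hamOn hj ζ h)⟩

/-- The Boltzmann factor `exp(-H_Λ(ζ; ξ))`. -/
def boltz (j : Pt d → ℂ) (Λ : Region d) (ζ : Multiset (Pt d)) (ξ : Config d) : ℝ≥0∞ :=
  ⨅ n, ratio j ζ (bdryPts j Λ ξ n)

theorem tendsto_boltz (hj : IsAdmissible j) {Λ : Region d} (ζ : Multiset (Pt d)) {ξ : Config d}
    (h : ξ ∈ possible j Λ) :
    Tendsto (fun n => ratio j ζ (bdryPts j Λ ξ n)) atTop (𝓝 (boltz j Λ ζ ξ)) :=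
  tendsto_atTop_iInf fun _ n hmn =>
    hj.ratio_anti ζ (bdryPts_mono Λ ξ hmn) (hj.mem_possible_iff.1 h n)

theorem boltz_le_gram (hj : IsAdmissible j) {Λ : Region d} (ζ : Multiset (Pt d)) {ξ : Config d}
    (h : ξ ∈ possible j Λ) : boltz j Λ ζ ξ ≤ gram j ζ :=
  (iInf_le _ 0).trans (hj.ratio_le_gram ζ (hj.mem_possible_iff.1 h 0))

theorem boltz_ne_top (hj : IsAdmissible j) {Λ : Region d} (ζ : Multiset (Pt d)) {ξ : Config d}
    (h : ξ ∈ possible j Λ) : boltz j Λ ζ ξ ≠ ∞ :=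
  ne_top_of_le_ne_top (gram_ne_top _) (boltz_le_gram hj ζ h)

theorem boltz_zero (hj : IsAdmissible j) {Λ : Region d} {ξ : Config d}
    (h : ξ ∈ possible j Λ) : boltz j Λ 0 ξ = 1 := by
  have : ∀ n, ratio j 0 (bdryPts j Λ ξ n) = 1 := fun n => by
    rw [ratio, zero_add, ENNReal.div_self (hj.mem_possible_iff.1 h n) (gram_ne_top _)]
  simp [boltz, this]

theorem tendsto_ballRegion : Tendsto (ballRegion d) atTop atTop :=
  tendsto_atTop_atTop_of_monotone ballRegion_mono fun D => exists_subset_ballRegion D.2.2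

theorem ham_eq (hj : IsAdmissible j) {Λ : Region d} {ζ : Multiset (Pt d)} {ξ : Config d}
    (hζ : ζ ∈ simpleIn Λ.1) (h : ξ ∈ possible j Λ) :
    ham j Λ ζ ξ = -ENNReal.log (boltz j Λ ζ ξ) := by
  refine tendsto_nhds_unique ((tendsto_hamOn hj hζ h).comp tendsto_ballRegion) ?_
  have h1 := (ENNReal.logOrderIso.continuous.tendsto _).comp (tendsto_boltz hj ζ h)
  have h2 := (continuous_neg.tendsto _).comp h1
  refine h2.congr fun n => ?_
  simp only [Function.comp]
  rw [hamOn_eq hj _ ζ h]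
  rfl

theorem exp_neg_ham (hj : IsAdmissible j) {Λ : Region d} {ζ : Multiset (Pt d)} {ξ : Config d}
    (hζ : ∀ x ∈ ζ, x ∈ Λ.1) (h : ξ ∈ possible j Λ) :
    EReal.exp (-ham j Λ ζ ξ) = boltz j Λ ζ ξ := by
  by_cases hn : ζ.Nodup
  · rw [ham_eq hj ⟨hn, hζ⟩ h, neg_neg, ENNReal.exp_log]
  -- With multiple points H is +∞ by convention, and `boltz` vanishes through the equal rows. The
  -- restriction to simple configurations can therefore be dropped from the integrals.
  · rw [ham, if_neg fun hc => hn hc.1.1, EReal.neg_top, EReal.exp_bot, eq_comm, ← le_zero_iff]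
    rw [← gram_eq_zero_of_not_nodup (j := j) hn]
    exact boltz_le_gram hj ζ h

/-! ### Decomposition of the energy -/

/-- The definition of R as an infimum gives this beyond R only. The case ‖z‖ = R follows by
continuity along c • z as c ↓ 1, where R > 0 ensures z ≠ 0 and hence that the norm really increases.
-/
theorem IsAdmissible.eq_zero_of_range_le (hj : IsAdmissible j) (hR : 0 < interactionRange j)
    {z : Pt d} (hz : interactionRange j ≤ ((‖z‖ : ℝ) : EReal)) : j z = 0 := by
  have hz0 : 0 < ‖z‖ := by exact_mod_cast hR.trans_le hz
  have hlim : Tendsto (fun c : ℝ => j (c • z)) (𝓝[>] 1) (𝓝 (j z)) := by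
    have : Continuous fun c : ℝ => j (c • z) := hj.continuous.comp (by fun_prop)
    simpa using (this.tendsto 1).mono_left nhdsWithin_le_nhds
  refine tendsto_nhds_unique hlim (tendsto_const_nhds.congr' ?_)
  filter_upwards [self_mem_nhdsWithin] with c hc
  have hc1 : (1 : ℝ) < c := hc
  have : interactionRange j < ((‖c • z‖ : ℝ) : EReal) := by
    refine hz.trans_lt ?_
    rw [EReal.coe_lt_coe_iff, norm_smul, Real.norm_of_nonneg (by linarith)]
    nlinarith
  obtain ⟨r, ⟨r', rfl, hr'⟩, hlt⟩ := sInf_lt_iff.1 this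
  exact (hr' _ (by exact_mod_cast hlt.le)).symm

/-- A chain from Λ can be cut at its last visit to Δ; what remains is a chain from Δ through
particles of ξ outside Δ. -/
theorem mem_nbhd_of_glue {Λ Δ : Set (Pt d)} (hΛ : Λ ⊆ Δ) {y : Multiset (Pt d)}
    (hy : ∀ p ∈ y, p ∈ Δ) {ξ : Config d} {x : Pt d}
    (hx : x ∈ nbhd j Λ (Config.glue Δ y ξ)) : x ∈ nbhd j Δ ξ := by
  classical
  rcases hx with h | ⟨k, hk⟩
  · exact Or.inl h
  refine Or.inr ?_
  induction k generalizing x with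
  | zero =>
    obtain ⟨p, hp, h⟩ := hk
    exact ⟨0, p, hΛ hp, h⟩
  | succ k ih =>
    obtain ⟨p, ⟨-, hp⟩, hpk, h⟩ := hk
    by_cases hpΔ : p ∈ Δ
    · exact ⟨0, p, hpΔ, h⟩
    · obtain ⟨m, hm⟩ := ih hpk
      refine ⟨m + 1, p, ⟨hpΔ, ?_⟩, hm, h⟩
      have : y.count p = 0 := Multiset.count_eq_zero_of_notMem fun hc => hpΔ (hy p hc)
      simpa [Config.glue, Config.restrict, hpΔ, this] using hp

-- The boundary particles of Λ in the glued configuration all come from y or from the boundary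
-- particles of Δ, and are exactly those lying in the region interacting with Λ.
open Classical in
theorem filter_bdryPts {Λ Δ : Region d} (hΛ : Λ.1 ⊆ Δ.1) {y : Multiset (Pt d)}
    (hy : ∀ p ∈ y, p ∈ Δ.1 \ Λ.1) (ξ : Config d) {n : ℕ} (hn : Δ.1 ⊆ (ballRegion d n).1) :
    (y + bdryPts j Δ ξ n).filter (· ∈ nbhd j Λ.1 (Config.glue Δ.1 y ξ)) =
      bdryPts j Λ (Config.glue Δ.1 y ξ) n := by
  rw [bdryPts, bdryPts, pts_boundary _ _ _ (isBounded_diff _ _),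
    pts_boundary _ _ _ (isBounded_diff _ _), Config.pts_glue, Multiset.filter_add,
    Multiset.filter_add, Multiset.filter_filter]
  · have ey : y.filter (· ∈ ((ballRegion d n).1 \ Λ.1) \ Λ.1) = y :=
      Multiset.filter_eq_self.2 fun p hp => ⟨⟨hn (hy p hp).1, (hy p hp).2⟩, (hy p hp).2⟩
    congr 1
    · congr 1
      convert ey.symm
    · have e : (((ballRegion d n).1 \ Λ.1) \ Λ.1) \ Δ.1 = ((ballRegion d n).1 \ Δ.1) \ Δ.1 := by
        ext p
        have := @hΛ p
        simp only [Set.mem_sdiff]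
        tauto
      rw [e]
      refine Multiset.filter_congr fun p _ => ?_
      exact ⟨fun h => h.1, fun h => ⟨h, mem_nbhd_of_glue hΛ (fun p hp => (hy p hp).1) h⟩⟩
  · exact (isBounded_diff _ _).subset sdiff_subset

/-- The discarded particles t are at distance at least R from Λ and from every boundary particle of
Λ: otherwise a chain could be extended to reach them. So t decouples, and it does not depend on x.
-/
theorem gram_add_bdryPts (hj : IsAdmissible j) (hR : 0 < interactionRange j) {Λ Δ : Region d}
    (hΛ : Λ.1 ⊆ Δ.1) {y : Multiset (Pt d)} (hy : ∀ p ∈ y, p ∈ Δ.1 \ Λ.1) (ξ : Config d) {n : ℕ}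
    (hn : Δ.1 ⊆ (ballRegion d n).1) : ∃ t : Multiset (Pt d), ∀ x : Multiset (Pt d),
      (∀ p ∈ x, p ∈ Λ.1) → gram j (x + (y + bdryPts j Δ ξ n)) =
        gram j (x + bdryPts j Λ (Config.glue Δ.1 y ξ) n) * gram j t := by
  classical
  set ω := Config.glue Δ.1 y ξ with hω
  refine ⟨(y + bdryPts j Δ ξ n).filter (· ∉ nbhd j Λ.1 ω), fun x hx => ?_⟩
  rw [← filter_bdryPts hΛ hy ξ hn, ← hj.gram_add_of_cross_zero, add_assoc,
    Multiset.filter_add_not]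
  intro u hu v hv
  refine hj.eq_zero_of_range_le hR ?_
  by_contra! hlt
  rw [← dist_eq_norm] at hlt
  refine (Multiset.mem_filter.1 hv).2 (Or.inr ?_)
  rcases Multiset.mem_add.1 hu with hu | hu
  · exact ⟨0, u, hx u hu, hlt⟩
  · rcases (Multiset.mem_filter.1 hu).2 with h | ⟨k, hk⟩
    · exact absurd (Or.inl h) (Multiset.mem_filter.1 hv).2
    · refine ⟨k + 1, u, ?_, hk, hlt⟩
      rw [filter_bdryPts hΛ hy ξ hn, bdryPts, Config.mem_pts (isBounded_diff _ _),
        mult_boundary] at hu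
      refine ⟨hu.1.2, fun h0 => hu.2 ?_⟩
      rw [h0, ite_self]

/-- A positive infimum forces every det J(y ξ̂, y ξ̂) to be nonzero, and the boundary particles of Λ
form a subcollection of y ξ̂ once the ball contains Δ. -/
theorem glue_mem_possible (hj : IsAdmissible j) {Λ Δ : Region d}
    (hΛ : Λ.1 ⊆ Δ.1) {y : Multiset (Pt d)} (hy : ∀ p ∈ y, p ∈ Δ.1 \ Λ.1) {ξ : Config d}
    (h : boltz j Δ y ξ ≠ 0) :
    Config.glue Δ.1 y ξ ∈ possible j Λ := by
  classical
  rw [hj.mem_possible_iff]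
  intro m
  obtain ⟨n, hn⟩ := exists_subset_ballRegion Δ.2.2
  have hle : bdryPts j Λ (Config.glue Δ.1 y ξ) m ≤
      bdryPts j Λ (Config.glue Δ.1 y ξ) (max m n) := bdryPts_mono _ _ (le_max_left _ _)
  refine hj.gram_ne_zero_of_le hle ?_
  rw [← filter_bdryPts hΛ hy ξ (hn.trans (ballRegion_mono (le_max_right m n)))]
  refine hj.gram_ne_zero_of_le (Multiset.filter_le _ _) fun h0 => h ?_
  refine le_antisymm ((iInf_le _ (max m n)).trans ?_) bot_le
  rw [ratio, h0, ENNReal.zero_div]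

/-- On every ball containing Δ the identity holds exactly for the ratios, by the chain rule and
cancellation of `gram j t`; then the radius tends to infinity. -/
theorem boltz_add (hj : IsAdmissible j) (hR : 0 < interactionRange j) {Λ Δ : Region d}
    (hΛ : Λ.1 ⊆ Δ.1) {x y : Multiset (Pt d)} (hx : ∀ p ∈ x, p ∈ Λ.1)
    (hy : ∀ p ∈ y, p ∈ Δ.1 \ Λ.1) {ξ : Config d} (hξ : ξ ∈ possible j Δ) (h : boltz j Δ y ξ ≠ 0) :
    boltz j Δ (x + y) ξ = boltz j Λ x (Config.glue Δ.1 y ξ) * boltz j Δ y ξ := by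
  have hω := glue_mem_possible hj hΛ hy h
  refine tendsto_nhds_unique (tendsto_boltz hj (x + y) hξ) ?_
  refine (ENNReal.Tendsto.mul (tendsto_boltz hj x hω) (Or.inr (boltz_ne_top hj y hξ))
    (tendsto_boltz hj y hξ) (Or.inr (boltz_ne_top hj x hω))).congr' ?_
  obtain ⟨n₀, hn₀⟩ := exists_subset_ballRegion Δ.2.2
  filter_upwards [eventually_ge_atTop n₀] with n hn
  have hn' := hn₀.trans (ballRegion_mono hn)
  have h0 : gram j (y + bdryPts j Δ ξ n) ≠ 0 := fun h0 => h <| by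
    refine le_antisymm ((iInf_le _ n).trans ?_) bot_le
    rw [ratio, h0, ENNReal.zero_div]
  obtain ⟨t, ht⟩ := gram_add_bdryPts hj hR hΛ hy ξ hn'
  have ht0 := ht 0 (by simp)
  rw [zero_add, zero_add] at ht0
  have htne : gram j t ≠ 0 := fun hc => h0 (by rw [ht0, hc, mul_zero])
  rw [← ratio_mul h0]
  congr 1
  rw [ratio, ratio, ht x hx, ht0, ENNReal.mul_div_mul_right _ _ htne (gram_ne_top _)]

/-- The ratio for x + y is at most `gram j x` times the ratio for y, uniformly in the environment.
-/
theorem boltz_add_eq_zero (hj : IsAdmissible j) {Δ : Region d} (x : Multiset (Pt d))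
    {y : Multiset (Pt d)} {ξ : Config d} (hξ : ξ ∈ possible j Δ) (h : boltz j Δ y ξ = 0) :
    boltz j Δ (x + y) ξ = 0 := by
  have hle : ∀ n, ratio j (x + y) (bdryPts j Δ ξ n) ≤
      gram j x * ratio j y (bdryPts j Δ ξ n) := fun n => by
    by_cases h0 : gram j (y + bdryPts j Δ ξ n) = 0
    · have : gram j (x + y + bdryPts j Δ ξ n) = 0 := by
        by_contra hc
        refine hj.gram_ne_zero_of_le ?_ hc h0
        rw [add_assoc]
        exact Multiset.le_add_left _ _
      rw [ratio, this, ENNReal.zero_div]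
      exact bot_le
    · rw [← ratio_mul h0]
      gcongr
      exact hj.ratio_le_gram x h0
  have h1 := ENNReal.Tendsto.const_mul (a := gram j x) (tendsto_boltz hj y hξ)
    (Or.inr (gram_ne_top x))
  rw [h, mul_zero] at h1
  exact le_antisymm (le_of_tendsto_of_tendsto' (tendsto_boltz hj (x + y) hξ) h1 hle) bot_le

/-! ### Measurability of sums over particles -/

open Classical in
/-- A multiset of points depends measurably on a parameter. -/
def MeasurablePts {α : Type*} [MeasurableSpace α] (κ : α → Multiset (Pt d)) : Prop :=
  ∀ B : Set (Pt d), MeasurableSet B → Measurable fun a => ((κ a).filter (· ∈ B)).card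

theorem MeasurablePts.comp {α β : Type*} [MeasurableSpace α] [MeasurableSpace β]
    {κ : α → Multiset (Pt d)} (hκ : MeasurablePts κ) {g : β → α} (hg : Measurable g) :
    MeasurablePts fun b => κ (g b) := fun B hB => (hκ B hB).comp hg

theorem MeasurablePts.measurable_card {α : Type*} [MeasurableSpace α] {κ : α → Multiset (Pt d)}
    (hκ : MeasurablePts κ) : Measurable fun a => (κ a).card := by
  simpa using hκ univ MeasurableSet.univ

/-- The point measure of a finite collection of points. -/
def pointMeasure (s : Multiset (Pt d)) : Measure (Pt d) := (s.map Measure.dirac).sum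

open Classical in
theorem pointMeasure_apply (s : Multiset (Pt d)) {B : Set (Pt d)} (hB : MeasurableSet B) :
    pointMeasure s B = (s.filter (· ∈ B)).card := by
  induction s using Multiset.induction with
  | empty => simp [pointMeasure]
  | cons x s ih =>
    have : pointMeasure (x ::ₘ s) = Measure.dirac x + pointMeasure s := by simp [pointMeasure]
    rw [this, Measure.add_apply, ih, Measure.dirac_apply' _ hB, Multiset.filter_cons]
    by_cases hx : x ∈ B <;> simp [hx, add_comm]

theorem lintegral_pointMeasure (s : Multiset (Pt d)) (f : Pt d → ℝ≥0∞) :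
    ∫⁻ x, f x ∂(pointMeasure s) = (s.map f).sum := by
  induction s using Multiset.induction with
  | empty => simp [pointMeasure]
  | cons x s ih =>
    have : pointMeasure (x ::ₘ s) = Measure.dirac x + pointMeasure s := by simp [pointMeasure]
    rw [this, lintegral_add_measure, ih, lintegral_dirac, Multiset.map_cons, Multiset.sum_cons]

-- The sum is an integral against the point measure, which is a kernel in the parameter. Cutting by
-- the number of points makes this kernel s-finite, as needed for integrands that depend on the
-- parameter.
open ProbabilityTheory in
theorem MeasurablePts.measurable_sum {α : Type*} [MeasurableSpace α] {κ : α → Multiset (Pt d)}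
    (hκ : MeasurablePts κ) {f : α → Pt d → ℝ≥0∞} (hf : Measurable (Function.uncurry f)) :
    Measurable fun a => ((κ a).map (f a)).sum := by
  classical
  have hm : Measurable fun a => pointMeasure (κ a) := by
    refine Measure.measurable_of_measurable_coe _ fun B hB => ?_
    simp only [pointMeasure_apply _ hB]
    exact (measurable_of_countable (fun n : ℕ => (n : ℝ≥0∞))).comp (hκ B hB)
  let K : Kernel α (Pt d) := ⟨fun a => pointMeasure (κ a), hm⟩
  have hS : ∀ n : ℕ, MeasurableSet {a | (κ a).card = n} := fun n =>
    hκ.measurable_card (measurableSet_singleton n)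
  let Kn : ℕ → Kernel α (Pt d) := fun n => Kernel.piecewise (hS n) K 0
  have hfin : ∀ n, IsFiniteKernel (Kn n) := fun n => by
    refine ⟨⟨n, ENNReal.natCast_lt_top n, fun a => ?_⟩⟩
    rw [Kernel.piecewise_apply]
    split_ifs with h
    · have h' : (κ a).card = n := h
      change pointMeasure (κ a) univ ≤ _
      rw [pointMeasure_apply _ MeasurableSet.univ]
      simp [h']
    · simp
  have hsum : K = Kernel.sum Kn := by
    ext a B hB
    rw [Kernel.sum_apply' _ _ hB, tsum_eq_single (κ a).card]
    · rw [Kernel.piecewise_apply, if_pos (show a ∈ {b | (κ b).card = (κ a).card} from rfl)]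
    · intro n hn
      rw [Kernel.piecewise_apply, if_neg (show a ∉ {b | (κ b).card = n} from fun h => hn (Eq.symm h))]
      simp
  have : IsSFiniteKernel K := ⟨Kn, hfin, hsum⟩
  have := Measurable.lintegral_kernel_prod_right (κ := K) hf
  simpa [K, lintegral_pointMeasure] using this

-- Induction on n: the first point is handled by `measurable_sum`, after becoming an additional
-- parameter for the sum over the others. This is why the parameter space is generalized.
open Classical in
theorem MeasurablePts.measurable_tuple_sum {α : Type*} [MeasurableSpace α]
    {κ : α → Multiset (Pt d)} (hκ : MeasurablePts κ) {n : ℕ} {F : α → (Fin n → Pt d) → ℝ≥0∞}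
    (hF : Measurable (Function.uncurry F)) :
    Measurable fun a => ∑ f : Fin n → (κ a).ToType, F a fun i => (f i).1 := by
  induction n generalizing α with
  | zero =>
    have : ∀ a, ∑ f : Fin 0 → (κ a).ToType, F a (fun i => (f i).1) = F a Fin.elim0 := fun a => by
      rw [Fintype.sum_unique]
      congr 1
      ext i
      exact i.elim0
    simp_rw [this]
    exact hF.comp (measurable_id.prodMk measurable_const)
  | succ n ih =>
    have e : ∀ a, ∑ f : Fin (n + 1) → (κ a).ToType, F a (fun i => (f i).1) =
        ((κ a).map fun x => ∑ f : Fin n → (κ a).ToType,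
          F a (Fin.cons x fun i => (f i).1 : Fin (n + 1) → Pt d)).sum := fun a => by
      rw [← (Fin.consEquiv fun _ => (κ a).ToType).sum_comp, Fintype.sum_prod_type,
        ← Multiset.map_univ (κ a)]
      refine Finset.sum_congr rfl fun x _ => Finset.sum_congr rfl fun f _ => ?_
      congr 1
      ext1 i
      refine Fin.cases ?_ (fun i => ?_) i <;> simp [Fin.consEquiv]
    simp_rw [e]
    refine hκ.measurable_sum ?_
    refine ih (κ := fun p : α × Pt d => κ p.1)
      (F := fun p y => F p.1 (Fin.cons p.2 y : Fin (n + 1) → Pt d))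
      (hκ.comp measurable_fst) ?_
    refine hF.comp (measurable_fst.fst.prodMk ?_)
    refine measurable_pi_lambda _ fun i => ?_
    refine Fin.cases ?_ (fun i => ?_) i
    · exact measurable_fst.snd
    · exact (measurable_pi_apply i).comp measurable_snd

-- Tuples that use a particle twice contribute zero, and the remaining ones are the n! enumerations
-- of s. A function of the unordered collection thus becomes a sum over ordered tuples.
open Classical in
theorem sum_gram_tuplePts (j : Pt d → ℂ) (t s : Multiset (Pt d)) {n : ℕ} (hn : s.card = n) :
    ∑ f : Fin n → s.ToType, gram j (t + tuplePts fun i => (f i).1) = n ! * gram j (t + s) := by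
  have hcard : Fintype.card s.ToType = n := by rw [← hn]; exact Multiset.card_coe s
  have h := Fintype.sum_of_injective (fun e : Fin n ≃ s.ToType => (e : Fin n → s.ToType))
    DFunLike.coe_injective (fun _ => gram j (t + s))
    (fun f => gram j (t + tuplePts fun i => (f i).1)) ?_ ?_
  · rw [← h, Finset.sum_const, Finset.card_univ,
      Fintype.card_equiv (Fintype.equivOfCardEq (by simp [hcard]))]
    simp
  · intro f hf
    refine gram_eq_zero_of_not_nodup fun hnd => hf ?_
    have h1 := Multiset.nodup_of_le (Multiset.le_add_left _ t) hnd
    have hinj : Function.Injective f := fun a b hab =>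
      Multiset.inj_on_of_nodup_map h1 a (by simp) b (by simp) (by simp [hab])
    exact ⟨Equiv.ofBijective f ((Fintype.bijective_iff_injective_and_card f).2
      ⟨hinj, by simp [hcard]⟩), rfl⟩
  · intro e
    congr 2
    have := congrArg (Multiset.map fun x : s.ToType => x.1) (Multiset.map_univ_val_equiv e)
    rw [Multiset.map_map, map_univ_toType] at this
    exact this.symm

theorem measurable_of_nat_index {α β : Type*} [MeasurableSpace α] [MeasurableSpace β] {N : α → ℕ}
    (hN : Measurable N) {f : α → β} {g : ℕ → α → β} (hg : ∀ n, Measurable (g n))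
    (h : ∀ a, f a = g (N a) a) : Measurable f := by
  have : Measurable fun p : α × ℕ => g p.2 p.1 := measurable_from_prod_countable_left hg
  have e : f = fun a => g (N a) a := funext h
  rw [e]
  exact this.comp (measurable_id.prodMk hN)

theorem continuous_gram_tuplePts_add (hj : IsAdmissible j) (m n : ℕ) :
    Continuous fun p : (Fin m → Pt d) × (Fin n → Pt d) =>
      gram j (tuplePts p.1 + tuplePts p.2) := by
  have : ∀ p : (Fin m → Pt d) × (Fin n → Pt d), gramDet j (tuplePts p.1 + tuplePts p.2) =
      Matrix.det (Matrix.of fun a b => j (Sum.elim p.1 p.2 a - Sum.elim p.1 p.2 b)) :=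
    fun p => gramDet_eq j (map_univ_sum_elim _ _)
  unfold gram
  simp_rw [this]
  refine ENNReal.continuous_ofReal.comp (Complex.continuous_re.comp ?_)
  have hc : ∀ a : Fin m ⊕ Fin n, Continuous fun p : (Fin m → Pt d) × (Fin n → Pt d) =>
      Sum.elim p.1 p.2 a := by
    rintro (a | a)
    · exact (continuous_apply a).comp continuous_fst
    · exact (continuous_apply a).comp continuous_snd
  refine Continuous.matrix_det (continuous_matrix fun a b => ?_)
  exact hj.continuous.comp ((hc a).sub (hc b))

theorem MeasurablePts.measurable_gram (hj : IsAdmissible j) {α : Type*} [MeasurableSpace α]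
    {κ : α → Multiset (Pt d)} (hκ : MeasurablePts κ) {m : ℕ} {x : α → Fin m → Pt d}
    (hx : Measurable x) : Measurable fun a => gram j (tuplePts (x a) + κ a) := by
  classical
  refine measurable_of_nat_index hκ.measurable_card
    (g := fun n a => (n ! : ℝ≥0∞)⁻¹ * ∑ f : Fin n → (κ a).ToType,
      gram j (tuplePts (x a) + tuplePts fun i => (f i).1)) (fun n => ?_) fun a => ?_
  · refine Measurable.const_mul (hκ.measurable_tuple_sum
      (F := fun a y => gram j (tuplePts (x a) + tuplePts y)) ?_) _
    have h2 : Measurable fun p : α × (Fin n → Pt d) => (x p.1, p.2) :=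
      (hx.comp measurable_fst).prodMk measurable_snd
    have h1 := (continuous_gram_tuplePts_add hj m n).measurable
    have h3 := h1.comp h2
    exact h3
  · rw [sum_gram_tuplePts j _ _ rfl, ← mul_assoc, ENNReal.inv_mul_cancel, one_mul]
    · exact_mod_cast Nat.factorial_ne_zero _
    · exact ENNReal.natCast_ne_top _

/-! ### Measurable families of configurations -/

/-- A family of configurations depends measurably on a parameter inside `D`. -/
def MeasurableOn {α : Type*} [MeasurableSpace α] (D : Set (Pt d)) (w : α → Config d) : Prop :=
  ∀ B : Set (Pt d), MeasurableSet B → Bornology.IsBounded B → B ⊆ D →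
    Measurable fun a => (w a).count B

theorem measurable_sigmaOn_iff {α : Type*} [MeasurableSpace α] {D : Set (Pt d)}
    {w : α → Config d} : Measurable[_, Config.sigmaOn D] w ↔ MeasurableOn D w := by
  rw [measurable_iff_comap_le, Config.sigmaOn, MeasurableSpace.comap_iSup, iSup_le_iff]
  constructor
  · intro h B hB hb hD
    have := h ⟨B, hB, hb, hD⟩
    rw [MeasurableSpace.comap_comp] at this
    exact measurable_iff_comap_le.2 this
  · intro h B
    rw [MeasurableSpace.comap_comp]
    exact measurable_iff_comap_le.1 (h B.1 B.2.1 B.2.2.1 B.2.2.2)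

theorem measurable_config_iff {α : Type*} [MeasurableSpace α] {w : α → Config d} :
    Measurable w ↔ MeasurableOn univ w := measurable_sigmaOn_iff

/-- Choosing the configurations themselves with 𝓕_D as parameter space turns the parametrized
statements into 𝓕_{Λᶜ}-measurability. -/
theorem measurableOn_id (D : Set (Pt d)) :
    @MeasurableOn d _ (Config.sigmaOn D) D (fun ξ => ξ) :=
  (@measurable_sigmaOn_iff d _ (Config.sigmaOn D) D _).1 measurable_id

section

variable {α : Type*} [MeasurableSpace α] {w : α → Config d}

theorem MeasurableOn.comp {D : Set (Pt d)} (hw : MeasurableOn D w) {β : Type*} [MeasurableSpace β]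
    {g : β → α} (hg : Measurable g) : MeasurableOn D fun b => w (g b) :=
  fun B hB hb hD => (hw B hB hb hD).comp hg

theorem MeasurableOn.measurablePts {D B : Set (Pt d)} (hw : MeasurableOn D w)
    (hB : MeasurableSet B) (hb : Bornology.IsBounded B) (hD : B ⊆ D) :
    MeasurablePts fun a => (w a).pts B := by
  classical
  intro A hA
  have : ∀ a, (((w a).pts B).filter (· ∈ A)).card = (w a).count (B ∩ A) := fun a => by
    rw [Config.filter_pts _ hb, Config.count_eq_card _ (hb.subset inter_subset_left)]
  convert hw _ (hB.inter hA) (hb.subset inter_subset_left) (inter_subset_left.trans hD) using 2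
  rw [← this]

/-! ### Measurability of reachability, boundary particles and Boltzmann factors. -/

theorem measurableSet_diff_ball (Λ : Region d) (n : ℕ) :
    MeasurableSet ((ballRegion d n).1 \ Λ.1) := (ballRegion d n).2.1.diff Λ.2.1

theorem isOpen_dist_lt (R : EReal) : IsOpen {p : Pt d × Pt d | ((dist p.1 p.2 : ℝ) : EReal) < R} :=
  isOpen_lt (continuous_coe_real_ereal.comp continuous_dist) continuous_const

theorem MeasurableOn.measurableSet_reach {Λ : Region d} (hw : MeasurableOn Λ.1ᶜ w) (k : ℕ) :
    MeasurableSet {p : α × Pt d | p.2 ∈ reach j Λ.1 (w p.1) k} := by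
  induction k with
  | zero =>
    have : IsOpen {x : Pt d | ∃ p ∈ Λ.1, ((dist x p : ℝ) : EReal) < interactionRange j} := by
      have e : {x : Pt d | ∃ p ∈ Λ.1, ((dist x p : ℝ) : EReal) < interactionRange j} =
          ⋃ p ∈ Λ.1, {x | ((dist x p : ℝ) : EReal) < interactionRange j} := by ext; simp
      rw [e]
      exact isOpen_biUnion fun p _ => (isOpen_dist_lt _).preimage
        (by fun_prop : Continuous fun x : Pt d => (x, p))
    exact measurable_snd this.measurableSet
  | succ k ih =>
    -- The point x is reached in one more step iff, in some ball, the sum of `f` over the particles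
    -- y outside Λ is nonzero: existence of a particle becomes nonvanishing of a measurable sum.
    let f : α × Pt d → Pt d → ℝ≥0∞ := fun p y =>
      ({p : α × Pt d | p.2 ∈ reach j Λ.1 (w p.1) k}.indicator 1 (p.1, y)) *
      ({p : Pt d × Pt d | ((dist p.1 p.2 : ℝ) : EReal) < interactionRange j}.indicator 1 (p.2, y))
    have hf : Measurable (Function.uncurry f) := by
      refine Measurable.mul ?_ ?_
      · exact (measurable_one.indicator ih).comp (measurable_fst.fst.prodMk measurable_snd)
      · exact (measurable_one.indicator (isOpen_dist_lt _).measurableSet).comp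
          (measurable_fst.snd.prodMk measurable_snd)
    have hm : ∀ m : ℕ, Measurable fun p : α × Pt d =>
        (((w p.1).pts ((ballRegion d m).1 \ Λ.1)).map (f p)).sum := fun m =>
      ((hw.measurablePts (measurableSet_diff_ball Λ m) (isBounded_diff _ _)
        (sdiff_subset_compl _ _)).comp measurable_fst).measurable_sum hf
    have e : {p : α × Pt d | p.2 ∈ reach j Λ.1 (w p.1) (k + 1)} = ⋃ m : ℕ,
        {p | (((w p.1).pts ((ballRegion d m).1 \ Λ.1)).map (f p)).sum = 0}ᶜ := by
      ext ⟨a, x⟩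
      have hne : ∀ s : Multiset (Pt d), (s.map (f (a, x))).sum ≠ 0 ↔ ∃ y ∈ s, f (a, x) y ≠ 0 :=
        fun s => by
          rw [Ne, Multiset.sum_eq_zero_iff]
          simp only [Multiset.mem_map]
          push Not
          exact ⟨fun ⟨z, ⟨y, hy, e⟩, h⟩ => ⟨y, hy, e ▸ h⟩, fun ⟨y, hy, h⟩ => ⟨_, ⟨y, hy, rfl⟩, h⟩⟩
      simp only [mem_iUnion, mem_compl_iff, mem_ofPred_eq]
      simp only [hne, Config.mem_pts (isBounded_diff _ _)]
      constructor
      · rintro ⟨y, hy, hyk, hd⟩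
        obtain ⟨m, hm⟩ := exists_subset_ballRegion (Bornology.isBounded_singleton (x := y))
        refine ⟨m, y, ⟨⟨hm rfl, hy.1⟩, hy.2⟩, ?_⟩
        simp [f, hyk, hd]
      · rintro ⟨m, y, ⟨hy, hy0⟩, hne⟩
        simp only [f, ne_eq, mul_eq_zero, not_or, indicator_apply_eq_zero, mem_ofPred_eq, Pi.one_apply,
          one_ne_zero, imp_false, not_not] at hne
        exact ⟨y, ⟨hy.2, hy0⟩, hne.1, hne.2⟩
    rw [e]
    exact MeasurableSet.iUnion fun m => (hm m (measurableSet_singleton 0)).compl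

theorem MeasurableOn.measurableSet_nbhd {Λ : Region d} (hw : MeasurableOn Λ.1ᶜ w) :
    MeasurableSet {p : α × Pt d | p.2 ∈ nbhd j Λ.1 (w p.1)} := by
  have : {p : α × Pt d | p.2 ∈ nbhd j Λ.1 (w p.1)} =
      {_p | interactionRange j = ⊤} ∪ ⋃ k, {p : α × Pt d | p.2 ∈ reach j Λ.1 (w p.1) k} := by
    ext p
    simp [nbhd]
  rw [this]
  exact (MeasurableSet.const _).union (MeasurableSet.iUnion fun k => hw.measurableSet_reach k)

theorem MeasurableOn.measurablePts_bdryPts {Λ : Region d} (hw : MeasurableOn Λ.1ᶜ w) (n : ℕ) :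
    MeasurablePts fun a => bdryPts j Λ (w a) n := by
  classical
  intro B hB
  let D : Set (Pt d) := ((ballRegion d n).1 \ Λ.1) \ Λ.1
  let f : α → Pt d → ℝ≥0∞ := fun a x =>
    ({p : α × Pt d | p.2 ∈ nbhd j Λ.1 (w p.1)} ∩ {p | p.2 ∈ B}).indicator 1 (a, x)
  have hf : Measurable (Function.uncurry f) :=
    measurable_one.indicator (hw.measurableSet_nbhd.inter (measurable_snd hB))
  have hm := (hw.measurablePts (B := D) ((measurableSet_diff_ball Λ n).diff Λ.2.1)
    ((isBounded_diff Λ (ballRegion d n)).subset sdiff_subset)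
    (sdiff_subset_compl _ _)).measurable_sum hf
  have e : ∀ a, (((w a).pts D).map (f a)).sum =
      (((bdryPts j Λ (w a) n).filter (· ∈ B)).card : ℝ≥0∞) := fun a => by
    rw [bdryPts, pts_boundary _ _ _ (isBounded_diff _ _), Multiset.filter_filter]
    change ((((w a).pts D).map (f a)).sum = (((((w a).pts D).filter _).card : ℕ) : ℝ≥0∞))
    induction (w a).pts D using Multiset.induction with
    | empty => simp
    | cons x s ih =>
      rw [Multiset.map_cons, Multiset.sum_cons, ih, Multiset.filter_cons]
      by_cases h1 : x ∈ nbhd j Λ.1 (w a) <;> by_cases h2 : x ∈ B <;>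
        simp [f, h1, h2, add_comm]
  simp_rw [e] at hm
  refine measurable_to_countable' fun k => ?_
  convert hm (measurableSet_singleton (k : ℝ≥0∞)) using 1
  ext a
  simp

theorem MeasurableOn.measurableSet_possible (hj : IsAdmissible j) {Λ : Region d}
    (hw : MeasurableOn Λ.1ᶜ w) : MeasurableSet {a | w a ∈ possible j Λ} := by
  simp only [hj.mem_possible_iff, ofPred_forall]
  refine MeasurableSet.iInter fun n => ?_
  have := (hw.measurablePts_bdryPts (j := j) n).measurable_gram hj (m := 0)
    (x := fun _ => Fin.elim0) measurable_const
  have h2 : ∀ a, gram j (tuplePts (Fin.elim0 : Fin 0 → Pt d) + bdryPts j Λ (w a) n) =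
      gram j (bdryPts j Λ (w a) n) := fun a => by simp [tuplePts]
  simp_rw [h2] at this
  exact (this (measurableSet_singleton 0)).compl

theorem MeasurableOn.measurable_boltz (hj : IsAdmissible j) {Λ : Region d}
    (hw : MeasurableOn Λ.1ᶜ w) {m : ℕ} {x : α → Fin m → Pt d} (hx : Measurable x) :
    Measurable fun a => boltz j Λ (tuplePts (x a)) (w a) := by
  refine Measurable.iInf fun n => ?_
  have h1 := (hw.measurablePts_bdryPts (j := j) n).measurable_gram hj hx
  have h2 := (hw.measurablePts_bdryPts (j := j) n).measurable_gram hj (m := 0)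
    (x := fun _ => Fin.elim0) measurable_const
  have h3 : ∀ a, gram j (tuplePts (Fin.elim0 : Fin 0 → Pt d) + bdryPts j Λ (w a) n) =
      gram j (bdryPts j Λ (w a) n) := fun a => by simp [tuplePts]
  simp_rw [h3] at h2
  exact h1.div h2

theorem MeasurableOn.glue {Λ : Region d} (hw : MeasurableOn Λ.1ᶜ w) {m : ℕ}
    {x : α → Fin m → Pt d} (hx : Measurable x) :
    Measurable fun a => Config.glue Λ.1 (tuplePts (x a)) (w a) := by
  classical
  rw [measurable_config_iff]
  intro B hB hb _
  have e : ∀ a, (Config.glue Λ.1 (tuplePts (x a)) (w a)).count B =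
      (∑ i, if x a i ∈ B then 1 else 0) + (w a).count (B \ Λ.1) := fun a => by
    rw [Config.count_eq_card _ hb, Config.pts_glue _ _ _ hb, Multiset.card_add,
      Config.count_eq_card _ (hb.subset sdiff_subset)]
    congr 1
    rw [tuplePts, Multiset.filter_map, Multiset.card_map, Finset.sum_boole]
    rfl
  simp_rw [e]
  refine Measurable.add (Finset.measurable_fun_sum _ fun i _ => ?_)
    (hw _ (hB.diff Λ.2.1) (hb.subset sdiff_subset) (sdiff_subset_compl _ _))
  exact Measurable.ite ((measurable_pi_apply i).comp hx hB) measurable_const measurable_const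

end

theorem measurableOn_const {α : Type*} [MeasurableSpace α] (D : Set (Pt d)) (ξ : Config d) :
    MeasurableOn D fun _ : α => ξ := fun _ _ _ _ => measurable_const

/-! ### Lebesgue–Poisson integrals -/

theorem tuplePts_cons {n : ℕ} (p : Pt d) (x : Fin n → Pt d) :
    tuplePts (Fin.cons p x : Fin (n + 1) → Pt d) = p ::ₘ tuplePts x := by
  rw [tuplePts, Fin.univ_succ]
  simp [tuplePts, Function.comp_def]

theorem tuplePts_append {m n : ℕ} (x : Fin m → Pt d) (y : Fin n → Pt d) :
    tuplePts (Fin.append x y) = tuplePts x + tuplePts y := by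
  rw [tuplePts, ← Multiset.map_univ_val_equiv finSumFinEquiv, Multiset.map_map]
  rw [tuplePts, tuplePts, ← map_univ_sum_elim x y]
  refine Multiset.map_congr rfl fun a _ => ?_
  rcases a with a | a <;> simp

theorem mem_tuplePts {n : ℕ} {x : Fin n → Pt d} {p : Pt d} : p ∈ tuplePts x ↔ ∃ i, x i = p := by
  simp [tuplePts]

theorem measurable_cons {n : ℕ} :
    Measurable fun q : Pt d × (Fin n → Pt d) => (Fin.cons q.1 q.2 : Fin (n + 1) → Pt d) := by
  refine measurable_pi_lambda _ fun i => ?_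
  refine Fin.cases ?_ (fun i => ?_) i
  · exact measurable_fst
  · exact (measurable_pi_apply i).comp measurable_snd

theorem measurable_append {m n : ℕ} :
    Measurable fun q : (Fin m → Pt d) × (Fin n → Pt d) => Fin.append q.1 q.2 := by
  refine measurable_pi_lambda _ fun i => ?_
  refine Fin.addCases (fun i => ?_) (fun i => ?_) i
  · simpa [Function.comp_def] using (measurable_pi_apply i).comp measurable_fst
  · simpa [Function.comp_def] using (measurable_pi_apply i).comp measurable_snd

/-- A function of finitely many points is measurable in the points. -/
def MeasurableTuple (F : Multiset (Pt d) → ℝ≥0∞) : Prop :=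
  ∀ n, Measurable fun x : Fin n → Pt d => F (tuplePts x)

/-- The integral of a function of `n` points with respect to `μⁿ`. -/
def tupleInt (μ : Measure (Pt d)) (n : ℕ) (F : Multiset (Pt d) → ℝ≥0∞) : ℝ≥0∞ :=
  ∫⁻ x, F (tuplePts x) ∂(Measure.pi fun _ : Fin n => μ)

theorem MeasurableTuple.add_right {F : Multiset (Pt d) → ℝ≥0∞} (hF : MeasurableTuple F) (m n : ℕ) :
    Measurable fun q : (Fin m → Pt d) × (Fin n → Pt d) => F (tuplePts q.1 + tuplePts q.2) := by
  have := (hF (m + n)).comp measurable_append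
  simpa only [Function.comp_def, tuplePts_append] using this

theorem MeasurableTuple.cons_joint {F : Multiset (Pt d) → ℝ≥0∞} (hF : MeasurableTuple F) (n : ℕ) :
    Measurable fun q : Pt d × (Fin n → Pt d) => F (q.1 ::ₘ tuplePts q.2) := by
  have := (hF (n + 1)).comp measurable_cons
  simpa only [Function.comp_def, tuplePts_cons] using this

theorem MeasurableTuple.cons {F : Multiset (Pt d) → ℝ≥0∞} (hF : MeasurableTuple F) (p : Pt d) :
    MeasurableTuple fun s => F (p ::ₘ s) := fun n =>
  (hF.cons_joint n).comp (measurable_const.prodMk measurable_id)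

theorem MeasurableTuple.add {F : Multiset (Pt d) → ℝ≥0∞} (hF : MeasurableTuple F) {m : ℕ}
    (y : Fin m → Pt d) : MeasurableTuple fun s => F (s + tuplePts y) := fun n =>
  (hF.add_right n m).comp (measurable_id.prodMk measurable_const)

theorem tupleInt_succ {μ : Measure (Pt d)} [SigmaFinite μ] {F : Multiset (Pt d) → ℝ≥0∞} (n : ℕ)
    (hF : Measurable fun x : Fin (n + 1) → Pt d => F (tuplePts x)) :
    tupleInt μ (n + 1) F = ∫⁻ p, tupleInt μ n (fun s => F (p ::ₘ s)) ∂μ := by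
  have hmp := (measurePreserving_piFinSuccAbove (fun _ : Fin (n + 1) => μ) 0).symm
  rw [tupleInt, ← hmp.lintegral_comp hF, lintegral_prod]
  · refine lintegral_congr fun p => lintegral_congr fun x => ?_
    change _ = F (p ::ₘ tuplePts x)
    rw [← tuplePts_cons]
    simp [MeasurableEquiv.piFinSuccAbove, Fin.consEquiv]
  · exact (hF.comp hmp.measurable).aemeasurable

theorem measurable_tupleInt_add {μ : Measure (Pt d)} [SigmaFinite μ] {F : Multiset (Pt d) → ℝ≥0∞}
    (hF : MeasurableTuple F) (n : ℕ) :
    MeasurableTuple fun s => tupleInt μ n fun x => F (x + s) := fun m =>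
  ((hF.add_right n m).comp measurable_swap).lintegral_prod_right'

/-- The binomial theorem for product measures: F sees only the unordered points, so only the number
of coordinates assigned to μ and to ν matters. -/
theorem tupleInt_add {μ ν : Measure (Pt d)} [SigmaFinite μ] [SigmaFinite ν] (n : ℕ)
    {F : Multiset (Pt d) → ℝ≥0∞} (hF : MeasurableTuple F) :
    tupleInt (μ + ν) n F = ∑ km ∈ Finset.HasAntidiagonal.antidiagonal n, (n.choose km.1 : ℝ≥0∞) *
      tupleInt ν km.2 fun y => tupleInt μ km.1 fun x => F (x + y) := by
  induction n generalizing F with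
  | zero =>
    simp [tupleInt, tuplePts]
  | succ n ih =>
    have hm : ∀ k m : ℕ, Measurable fun q : Pt d × (Fin m → Pt d) =>
        tupleInt μ k fun x => F (x + q.1 ::ₘ tuplePts q.2) := fun k m => by
      have := (measurable_tupleInt_add (μ := μ) hF k).cons_joint m
      exact this
    have hm' : ∀ k m : ℕ, Measurable fun p : Pt d =>
        tupleInt ν m fun y => tupleInt μ k fun x => F (x + p ::ₘ y) := fun k m =>
      (hm k m).lintegral_prod_right'
    have e1 : ∀ k m : ℕ, ∫⁻ p, (tupleInt ν m fun y => tupleInt μ k fun x => F (x + p ::ₘ y)) ∂ν =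
        tupleInt ν (m + 1) fun y => tupleInt μ k fun x => F (x + y) := fun k m =>
      (tupleInt_succ (F := fun s => tupleInt μ k fun x => F (x + s)) m
        (measurable_tupleInt_add hF k (m + 1))).symm
    have e2 : ∀ k m : ℕ, ∫⁻ p, (tupleInt ν m fun y => tupleInt μ k fun x => F (x + p ::ₘ y)) ∂μ =
        tupleInt ν m fun y => tupleInt μ (k + 1) fun x => F (x + y) := fun k m => by
      unfold tupleInt
      rw [lintegral_lintegral_swap (hm k m).aemeasurable]
      refine lintegral_congr fun y => ?_
      refine Eq.trans ?_ (tupleInt_succ (F := fun x => F (x + tuplePts y)) k (hF.add y (k + 1))).symm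
      refine lintegral_congr fun p => lintegral_congr fun x => ?_
      simp
    have hstep : ∀ p, tupleInt (μ + ν) n (fun s => F (p ::ₘ s)) =
        ∑ km ∈ Finset.HasAntidiagonal.antidiagonal n, (n.choose km.1 : ℝ≥0∞) *
          tupleInt ν km.2 fun y => tupleInt μ km.1 fun x => F (x + p ::ₘ y) := fun p => by
      rw [ih (hF.cons p)]
      simp
    rw [tupleInt_succ n (hF (n + 1))]
    simp_rw [hstep]
    rw [lintegral_finsetSum _ fun km _ => (hm' km.1 km.2).const_mul _]
    simp_rw [fun km : ℕ × ℕ => lintegral_const_mul (μ := μ + ν) (n.choose km.1 : ℝ≥0∞)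
      (hm' km.1 km.2), lintegral_add_measure, e1, e2, mul_add, Finset.sum_add_distrib]
    rw [Finset.sum_antidiagonal_choose_succ_mul
      (fun k m => tupleInt ν m fun y => tupleInt μ k fun x => F (x + y)), add_comm]
    congr 1
    refine Finset.sum_congr rfl fun km hkm => ?_
    rw [Nat.choose_symm_of_eq_add (Finset.HasAntidiagonal.mem_antidiagonal.1 hkm).symm]

/-- The Lebesgue–Poisson integral over the finite configurations in `D`. -/
def poissonInt (D : Set (Pt d)) (F : Multiset (Pt d) → ℝ≥0∞) : ℝ≥0∞ :=
  ∑' n : ℕ, ((n ! : ℕ) : ℝ≥0∞)⁻¹ * ∫⁻ x in cube D n, F (tuplePts x)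

theorem setLIntegral_cube (D : Set (Pt d)) (n : ℕ) (F : Multiset (Pt d) → ℝ≥0∞) :
    ∫⁻ x in cube D n, F (tuplePts x) = tupleInt (volume.restrict D) n F := by
  rw [tupleInt, cube, volume_pi, Measure.restrict_pi_pi]

theorem poissonInt_eq (D : Set (Pt d)) (F : Multiset (Pt d) → ℝ≥0∞) : poissonInt D F =
    ∑' n : ℕ, ((n ! : ℕ) : ℝ≥0∞)⁻¹ * tupleInt (volume.restrict D) n F :=
  tsum_congr fun n => by rw [setLIntegral_cube]

theorem measurableSet_cube {D : Set (Pt d)} (hD : MeasurableSet D) (n : ℕ) :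
    MeasurableSet (cube D n) := MeasurableSet.univ_pi fun _ => hD

theorem mem_of_mem_cube {D : Set (Pt d)} {n : ℕ} {x : Fin n → Pt d} (hx : x ∈ cube D n) :
    ∀ p ∈ tuplePts x, p ∈ D := by
  intro p hp
  obtain ⟨i, rfl⟩ := mem_tuplePts.1 hp
  exact hx i (mem_univ i)

theorem poissonInt_mono {D : Set (Pt d)} (hD : MeasurableSet D) {F G : Multiset (Pt d) → ℝ≥0∞}
    (h : ∀ s, (∀ p ∈ s, p ∈ D) → F s ≤ G s) : poissonInt D F ≤ poissonInt D G := by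
  refine ENNReal.tsum_le_tsum fun n => ?_
  refine mul_le_mul_right ?_ _
  exact setLIntegral_mono' (measurableSet_cube hD n) fun x hx => h _ (mem_of_mem_cube hx)

theorem poissonInt_congr {D : Set (Pt d)} (hD : MeasurableSet D) {F G : Multiset (Pt d) → ℝ≥0∞}
    (h : ∀ s, (∀ p ∈ s, p ∈ D) → F s = G s) : poissonInt D F = poissonInt D G :=
  le_antisymm (poissonInt_mono hD fun s hs => (h s hs).le)
    (poissonInt_mono hD fun s hs => (h s hs).ge)

theorem poissonInt_const_mul {D : Set (Pt d)} {c : ℝ≥0∞} (hc : c ≠ ∞)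
    (F : Multiset (Pt d) → ℝ≥0∞) : poissonInt D (fun s => c * F s) = c * poissonInt D F := by
  unfold poissonInt
  rw [← ENNReal.tsum_mul_left]
  refine tsum_congr fun n => ?_
  rw [lintegral_const_mul' _ _ hc]
  ring

/-- The weights satisfy (1/n!) · n!/(k! m!) = (1/k!) (1/m!), so the double sum over k + m = n
becomes a product sum. -/
theorem poissonInt_split {Λ Δ : Set (Pt d)} (hΛ : MeasurableSet Λ)
    (h : Λ ⊆ Δ) {F : Multiset (Pt d) → ℝ≥0∞} (hF : MeasurableTuple F) :
    poissonInt Δ F = poissonInt (Δ \ Λ) fun y => poissonInt Λ fun x => F (x + y) := by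
  have hvol : (volume : Measure (Pt d)).restrict Δ =
      volume.restrict Λ + volume.restrict (Δ \ Λ) := by
    have := Measure.restrict_inter_add_sdiff (μ := (volume : Measure (Pt d))) Δ hΛ
    rw [inter_eq_self_of_subset_right h] at this
    exact this.symm
  simp_rw [poissonInt_eq]
  rw [hvol]
  set μ := (volume : Measure (Pt d)).restrict Λ
  set ν := (volume : Measure (Pt d)).restrict (Δ \ Λ)
  simp_rw [tupleInt_add _ hF]
  set A : ℕ → ℕ → ℝ≥0∞ := fun k m => tupleInt ν m fun y => tupleInt μ k fun x => F (x + y) with hA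
  have hL : ∀ n : ℕ, ((n ! : ℕ) : ℝ≥0∞)⁻¹ * ∑ km ∈ Finset.HasAntidiagonal.antidiagonal n,
      (n.choose km.1 : ℝ≥0∞) * A km.1 km.2 = ∑ km ∈ Finset.HasAntidiagonal.antidiagonal n,
        ((km.1 ! : ℕ) : ℝ≥0∞)⁻¹ * ((km.2 ! : ℕ) : ℝ≥0∞)⁻¹ * A km.1 km.2 := fun n => by
    rw [Finset.mul_sum]
    refine Finset.sum_congr rfl fun km hkm => ?_
    rw [← mul_assoc]
    congr 1
    obtain rfl := Finset.HasAntidiagonal.mem_antidiagonal.1 hkm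
    have hne : ∀ i : ℕ, ((i ! : ℕ) : ℝ≥0∞) ≠ 0 := fun i => by
      exact_mod_cast Nat.factorial_ne_zero i
    have ht : ∀ i : ℕ, ((i ! : ℕ) : ℝ≥0∞) ≠ ∞ := fun i => ENNReal.natCast_ne_top _
    rw [← Nat.add_choose_mul_factorial_mul_factorial km.1 km.2,
      Nat.choose_symm_add]
    push_cast
    have hc : ((km.1 + km.2).choose km.2 : ℝ≥0∞) ≠ 0 := by
      exact_mod_cast (Nat.choose_pos (Nat.le_add_left _ _)).ne'
    rw [mul_assoc, ENNReal.mul_inv (Or.inl hc) (Or.inl (ENNReal.natCast_ne_top _)),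
      ENNReal.mul_inv (Or.inl (hne _)) (Or.inl (ht _)), mul_right_comm,
      ENNReal.inv_mul_cancel hc (ENNReal.natCast_ne_top _), one_mul]
  have hR : ∀ m : ℕ, (tupleInt ν m fun y => ∑' k : ℕ, ((k ! : ℕ) : ℝ≥0∞)⁻¹ *
      tupleInt μ k fun x => F (x + y)) = ∑' k : ℕ, ((k ! : ℕ) : ℝ≥0∞)⁻¹ * A k m := fun m => by
    rw [tupleInt, lintegral_tsum fun k =>
      ((measurable_tupleInt_add hF k m).const_mul _).aemeasurable]
    refine tsum_congr fun k => ?_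
    rw [lintegral_const_mul _ (measurable_tupleInt_add hF k m)]
    rfl
  simp_rw [hR]
  calc _ = ∑' n : ℕ, ∑ km ∈ Finset.HasAntidiagonal.antidiagonal n,
        ((km.1 ! : ℕ) : ℝ≥0∞)⁻¹ * ((km.2 ! : ℕ) : ℝ≥0∞)⁻¹ * A km.1 km.2 := tsum_congr hL
    _ = ∑' km : ℕ × ℕ, ((km.1 ! : ℕ) : ℝ≥0∞)⁻¹ * ((km.2 ! : ℕ) : ℝ≥0∞)⁻¹ * A km.1 km.2 := by
        rw [← Finset.HasAntidiagonal.sigmaAntidiagonalEquivProd.tsum_eq, ENNReal.tsum_sigma']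
        refine tsum_congr fun n => ?_
        rw [tsum_fintype, Finset.univ_eq_attach, ← Finset.sum_attach (Finset.HasAntidiagonal.antidiagonal n)]
        rfl
    _ = _ := by
        rw [ENNReal.tsum_prod', ENNReal.tsum_comm]
        refine tsum_congr fun m => ?_
        rw [← ENNReal.tsum_mul_left]
        refine tsum_congr fun k => ?_
        ring

theorem measurable_poissonInt {α : Type*} [MeasurableSpace α] {F : α → Multiset (Pt d) → ℝ≥0∞}
    (hF : ∀ n, Measurable fun q : α × (Fin n → Pt d) => F q.1 (tuplePts q.2)) (D : Set (Pt d)) :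
    Measurable fun a => poissonInt D (F a) :=
  Measurable.tsum fun n => Measurable.const_mul (hF n).lintegral_prod_right' _

/-- The integral is the exponential series of c times the volume of D. -/
theorem poissonInt_pow_ne_top (D : Region d) {c : ℝ≥0∞} (hc : c ≠ ∞) :
    poissonInt D.1 (fun s => c ^ s.card) ≠ ∞ := by
  have hv : volume D.1 ≠ ∞ := D.2.2.measure_lt_top.ne
  set b := c * volume D.1
  have hb : b ≠ ∞ := ENNReal.mul_ne_top hc hv
  have : poissonInt D.1 (fun s => c ^ s.card) =
      ∑' n : ℕ, ENNReal.ofReal (b.toReal ^ n / n !) := by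
    refine tsum_congr fun n => ?_
    have e : ∀ x : Fin n → Pt d, (tuplePts x).card = n := fun x => by simp [tuplePts]
    simp only [e]
    rw [lintegral_const, Measure.restrict_apply_univ, cube, volume_pi_pi, Finset.prod_const,
      Finset.card_univ, Fintype.card_fin, ← mul_pow,
      ENNReal.ofReal_div_of_pos (by exact_mod_cast n.factorial_pos),
      ENNReal.ofReal_pow ENNReal.toReal_nonneg, ENNReal.ofReal_toReal hb, ENNReal.ofReal_natCast,
      ENNReal.div_eq_inv_mul]
  rw [this]
  exact (Real.summable_pow_div_factorial _).tsum_ofReal_ne_top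

/-! ### The Gibbsian kernels -/

theorem measurableSet_simpleIn (Λ : Region d) (n : ℕ) :
    MeasurableSet {x : Fin n → Pt d | tuplePts x ∈ simpleIn Λ.1} := by
  have : {x : Fin n → Pt d | tuplePts x ∈ simpleIn Λ.1} =
      (⋂ (a : Fin n) (b : Fin n), {x | x a = x b → a = b}) ∩ ⋂ a : Fin n, {x | x a ∈ Λ.1} := by
    ext x
    simp only [simpleIn, mem_ofPred_eq, mem_tuplePts, mem_inter_iff, mem_iInter,
      forall_exists_index, forall_apply_eq_imp_iff]
    refine and_congr ?_ Iff.rfl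
    rw [tuplePts, Multiset.nodup_map_iff_inj_on Finset.univ.nodup]
    simp
  rw [this]
  refine (MeasurableSet.iInter fun a => MeasurableSet.iInter fun b => ?_).inter
    (MeasurableSet.iInter fun a => measurable_pi_apply a Λ.2.1)
  by_cases h : a = b
  · simp [h]
  · simp only [h, imp_false]
    exact (measurableSet_eq_fun (measurable_pi_apply a) (measurable_pi_apply b)).compl

theorem measurable_boltz_tuplePts (hj : IsAdmissible j) (Λ : Region d) (ξ : Config d) (n : ℕ) :
    Measurable fun x : Fin n → Pt d => boltz j Λ (tuplePts x) ξ :=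
  (measurableOn_const Λ.1ᶜ ξ).measurable_boltz hj measurable_id

theorem measurable_ham (hj : IsAdmissible j) (Λ : Region d) (ξ : Config d) (n : ℕ) :
    Measurable fun x : Fin n → Pt d => ham j Λ (tuplePts x) ξ := by
  classical
  by_cases hξ : ξ ∈ possible j Λ
  · have : (fun x : Fin n → Pt d => ham j Λ (tuplePts x) ξ) = fun x =>
        if tuplePts x ∈ simpleIn Λ.1 then -ENNReal.log (boltz j Λ (tuplePts x) ξ) else ⊤ := by
      ext x
      split_ifs with h
      · exact ham_eq hj h hξ
      · rw [ham, if_neg fun hc => h hc.1]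
    rw [this]
    exact Measurable.ite (measurableSet_simpleIn Λ n)
      ((ENNReal.measurable_log.comp (measurable_boltz_tuplePts hj Λ ξ n)).neg) measurable_const
  · simp [ham, hξ]

theorem measurable_density (hj : IsAdmissible j) (Λ : Region d) (ξ : Config d) (n : ℕ) :
    Measurable fun x : Fin n → Pt d => density j Λ (tuplePts x) ξ := by
  classical
  by_cases hξ : ξ ∈ possible j Λ
  · simp only [density, hξ, and_true]
    exact Measurable.ite (measurableSet_simpleIn Λ n) ((EReal.measurable_exp.comp
      (measurable_ham hj Λ ξ n).neg).const_mul _) measurable_const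
  · simp [density, hξ]

theorem density_eq (hj : IsAdmissible j) {Λ : Region d} {ξ : Config d} (hξ : ξ ∈ possible j Λ)
    {s : Multiset (Pt d)} (hs : ∀ p ∈ s, p ∈ Λ.1) :
    density j Λ s ξ = (partitionFn j Λ ξ)⁻¹ * boltz j Λ s ξ := by
  classical
  rw [density, ← exp_neg_ham hj hs hξ]
  split_ifs with h
  · rfl
  · rw [ham, if_neg h, EReal.neg_top, EReal.exp_bot, mul_zero]

theorem partitionFn_eq (hj : IsAdmissible j) {Λ : Region d} {ξ : Config d}
    (hξ : ξ ∈ possible j Λ) : partitionFn j Λ ξ = poissonInt Λ.1 fun s => boltz j Λ s ξ :=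
  poissonInt_congr (F := fun s => EReal.exp (-ham j Λ s ξ)) Λ.2.1 fun _ hs => exp_neg_ham hj hs hξ

theorem one_le_partitionFn (hj : IsAdmissible j) {Λ : Region d} {ξ : Config d}
    (hξ : ξ ∈ possible j Λ) : 1 ≤ partitionFn j Λ ξ := by
  rw [partitionFn_eq hj hξ, poissonInt]
  refine le_trans ?_ (ENNReal.le_tsum 0)
  rw [setLIntegral_cube Λ.1 0 fun s => boltz j Λ s ξ]
  simp [tupleInt, tuplePts, boltz_zero hj hξ]

theorem partitionFn_le (hj : IsAdmissible j) {Λ : Region d} {ξ : Config d}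
    (hξ : ξ ∈ possible j Λ) : partitionFn j Λ ξ ≤ poissonInt Λ.1 (gram j) := by
  rw [partitionFn_eq hj hξ]
  exact poissonInt_mono Λ.2.1 fun s _ => boltz_le_gram hj s hξ

theorem poissonInt_gram_ne_top (hj : IsAdmissible j) (Λ : Region d) :
    poissonInt Λ.1 (gram j) ≠ ∞ :=
  ne_top_of_le_ne_top (poissonInt_pow_ne_top Λ ENNReal.ofReal_ne_top)
    (poissonInt_mono Λ.2.1 fun s _ => hj.gram_le_pow s)

theorem partitionFn_ne_top (hj : IsAdmissible j) {Λ : Region d} {ξ : Config d}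
    (hξ : ξ ∈ possible j Λ) : partitionFn j Λ ξ ≠ ∞ :=
  ne_top_of_le_ne_top (poissonInt_gram_ne_top hj Λ) (partitionFn_le hj hξ)

theorem partitionFn_ne_zero (hj : IsAdmissible j) {Λ : Region d} {ξ : Config d}
    (hξ : ξ ∈ possible j Λ) : partitionFn j Λ ξ ≠ 0 :=
  (zero_lt_one.trans_le (one_le_partitionFn hj hξ)).ne'

theorem measurable_glue_tuplePts (Λ : Region d) (ξ : Config d) (n : ℕ) :
    Measurable fun x : Fin n → Pt d => Config.glue Λ.1 (tuplePts x) ξ :=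
  (measurableOn_const Λ.1ᶜ ξ).glue measurable_id

theorem lintegral_kernel_eq (hj : IsAdmissible j) (Λ : Region d) (ξ : Config d)
    {g : Config d → ℝ≥0∞} (hg : Measurable g) : ∫⁻ ζ, g ζ ∂(kernel j Λ ξ) =
      poissonInt Λ.1 fun s => density j Λ s ξ * g (Config.glue Λ.1 s ξ) := by
  rw [kernel, lintegral_sum_measure, poissonInt]
  refine tsum_congr fun n => ?_
  have hgl := measurable_glue_tuplePts Λ ξ n
  rw [lintegral_smul_measure, lintegral_map hg hgl,
    lintegral_withDensity_eq_lintegral_mul _ (measurable_density hj Λ ξ n)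
      (g := fun x => g (Config.glue Λ.1 (tuplePts x) ξ)) (hg.comp hgl)]
  rfl

theorem kernel_eq_zero (hj : IsAdmissible j) {Λ : Region d} {ξ : Config d}
    (hξ : ξ ∉ possible j Λ) : kernel j Λ ξ = 0 := by
  rw [← Measure.measure_univ_eq_zero, ← lintegral_one, lintegral_kernel_eq hj _ _ measurable_const]
  simp [poissonInt, density, hξ]

theorem lintegral_kernel (hj : IsAdmissible j) {Λ : Region d} {ξ : Config d}
    (hξ : ξ ∈ possible j Λ) {g : Config d → ℝ≥0∞} (hg : Measurable g) :
    ∫⁻ ζ, g ζ ∂(kernel j Λ ξ) = (partitionFn j Λ ξ)⁻¹ *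
      poissonInt Λ.1 fun s => boltz j Λ s ξ * g (Config.glue Λ.1 s ξ) := by
  rw [lintegral_kernel_eq hj Λ ξ hg,
    ← poissonInt_const_mul (ENNReal.inv_ne_top.2 (partitionFn_ne_zero hj hξ))]
  refine poissonInt_congr Λ.2.1 fun s hs => ?_
  rw [density_eq hj hξ hs, mul_assoc]

theorem kernel_apply (hj : IsAdmissible j) {Λ : Region d} {ξ : Config d}
    (hξ : ξ ∈ possible j Λ) {A : Set (Config d)} (hA : MeasurableSet A) :
    kernel j Λ ξ A = (partitionFn j Λ ξ)⁻¹ *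
      poissonInt Λ.1 fun s => boltz j Λ s ξ * A.indicator 1 (Config.glue Λ.1 s ξ) := by
  rw [← lintegral_kernel hj hξ (measurable_one.indicator hA), lintegral_indicator_one hA]

theorem isProbabilityMeasure_kernel (hj : IsAdmissible j) {Λ : Region d} {ξ : Config d}
    (hξ : ξ ∈ possible j Λ) : IsProbabilityMeasure (kernel j Λ ξ) := by
  refine ⟨?_⟩
  rw [kernel_apply hj hξ MeasurableSet.univ]
  simp only [indicator_univ, Pi.one_apply, mul_one]
  rw [← partitionFn_eq hj hξ, ENNReal.inv_mul_cancel (partitionFn_ne_zero hj hξ)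
    (partitionFn_ne_top hj hξ)]

theorem isFiniteMeasure_kernel (hj : IsAdmissible j) (Λ : Region d) (ξ : Config d) :
    IsFiniteMeasure (kernel j Λ ξ) := by
  by_cases hξ : ξ ∈ possible j Λ
  · have := isProbabilityMeasure_kernel hj hξ
    infer_instance
  · rw [kernel_eq_zero hj hξ]
    infer_instance

theorem density_ne_top (hj : IsAdmissible j) {Λ : Region d} (ξ : Config d)
    {s : Multiset (Pt d)} (hs : ∀ p ∈ s, p ∈ Λ.1) : density j Λ s ξ ≠ ∞ := by
  by_cases hξ : ξ ∈ possible j Λ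
  · rw [density_eq hj hξ hs]
    exact ENNReal.mul_ne_top (ENNReal.inv_ne_top.2 (partitionFn_ne_zero hj hξ))
      (boltz_ne_top hj s hξ)
  · simp [density, hξ]

theorem hasSum_integral_kernel (hj : IsAdmissible j) (Λ : Region d) (ξ : Config d)
    {f : Config d → ℝ} (hf : Measurable f) (hb : ∃ C, ∀ ζ, |f ζ| ≤ C) :
    HasSum (fun n : ℕ => ((n ! : ℕ) : ℝ)⁻¹ *
      ∫ x in cube Λ.1 n, (density j Λ (tuplePts x) ξ).toReal *
        f (Config.glue Λ.1 (tuplePts x) ξ)) (∫ ζ, f ζ ∂(kernel j Λ ξ)) := by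
  obtain ⟨C, hC⟩ := hb
  have hfin := isFiniteMeasure_kernel hj Λ ξ
  have hint : Integrable f (kernel j Λ ξ) :=
    Integrable.of_bound hf.aestronglyMeasurable C (Eventually.of_forall hC)
  refine (hasSum_integral_measure hint).congr_fun ?_
  intro n
  have hgl := measurable_glue_tuplePts Λ ξ n
  rw [integral_smul_measure, integral_map hgl.aemeasurable hf.aestronglyMeasurable,
    integral_withDensity_eq_integral_toReal_smul (measurable_density hj Λ ξ n)]
  · simp
  · refine (ae_restrict_iff' (measurableSet_cube Λ.2.1 n)).2 (Eventually.of_forall fun x hx => ?_)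
    exact (density_ne_top hj ξ (mem_of_mem_cube hx)).lt_top

/-! ### The specification -/

theorem sigmaOn_mono {D D' : Set (Pt d)} (h : D ⊆ D') :
    Config.sigmaOn D ≤ Config.sigmaOn D' := by
  refine iSup_le fun B => ?_
  exact le_iSup (fun B : {B : Set (Pt d) // MeasurableSet B ∧ Bornology.IsBounded B ∧ B ⊆ D'} =>
    MeasurableSpace.comap (fun ξ : Config d => ξ.count B.1) ⊤) ⟨B.1, B.2.1, B.2.2.1, B.2.2.2.trans h⟩

theorem mem_iff_of_restrict_eq {D : Set (Pt d)} {A : Set (Config d)}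
    (hA : MeasurableSet[Config.sigmaOn D] A) {ξ η : Config d} (h : ξ.restrict D = η.restrict D) :
    ξ ∈ A ↔ η ∈ A := by
  -- The generating counts factor through the restriction to D. With the discrete σ-algebra on the
  -- target, measurability of the restriction map plays no role.
  have hle : Config.sigmaOn D ≤ MeasurableSpace.comap (fun ξ : Config d => ξ.restrict D) ⊤ := by
    refine iSup_le fun B => ?_
    rintro _ ⟨S, -, rfl⟩
    refine ⟨{ζ | ζ.count B.1 ∈ S}, trivial, ?_⟩
    ext ζ
    simp only [mem_preimage, mem_ofPred_eq]
    rw [Config.count_eq_card _ B.2.2.1, Config.count_eq_card _ B.2.2.1,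
      Config.pts_restrict _ B.2.2.1, inter_eq_self_of_subset_left B.2.2.2]
  obtain ⟨S, -, rfl⟩ := hle A hA
  simp [h]

theorem eq_of_restrict_eq {D : Set (Pt d)} {g : Config d → ℝ≥0∞}
    (hg : Measurable[Config.sigmaOn D] g) {ξ η : Config d} (h : ξ.restrict D = η.restrict D) :
    g ξ = g η :=
  ((mem_iff_of_restrict_eq (hg (measurableSet_singleton (g ξ))) h).1 rfl).symm

theorem measurableSet_possible (hj : IsAdmissible j) (Λ : Region d) :
    MeasurableSet[Config.sigmaOn Λ.1ᶜ] (possible j Λ) :=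
  @MeasurableOn.measurableSet_possible d j (Config d) (Config.sigmaOn Λ.1ᶜ) (fun ξ => ξ) hj Λ
    (measurableOn_id Λ.1ᶜ)

theorem MeasurableOn.measurable_poissonInt_boltz (hj : IsAdmissible j) {α : Type*}
    [MeasurableSpace α] {w : α → Config d} {Λ : Region d} (hw : MeasurableOn Λ.1ᶜ w)
    {g : Config d → ℝ≥0∞} (hg : Measurable g) : Measurable fun a =>
      poissonInt Λ.1 fun s => boltz j Λ s (w a) * g (Config.glue Λ.1 s (w a)) := by
  refine measurable_poissonInt
    (F := fun a s => boltz j Λ s (w a) * g (Config.glue Λ.1 s (w a))) (fun n => ?_) Λ.1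
  have hw' : MeasurableOn Λ.1ᶜ fun q : α × (Fin n → Pt d) => w q.1 := hw.comp measurable_fst
  exact (hw'.measurable_boltz hj measurable_snd).mul (hg.comp (hw'.glue measurable_snd))

theorem MeasurableOn.measurable_kernel (hj : IsAdmissible j) {α : Type*}
    [MeasurableSpace α] {w : α → Config d} {Λ : Region d} (hw : MeasurableOn Λ.1ᶜ w)
    {A : Set (Config d)} (hA : MeasurableSet A) : Measurable fun a => kernel j Λ (w a) A := by
  classical
  have e : ∀ a, kernel j Λ (w a) A = if w a ∈ possible j Λ then
      (poissonInt Λ.1 fun s => boltz j Λ s (w a) * (fun _ => 1) (Config.glue Λ.1 s (w a)))⁻¹ *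
        poissonInt Λ.1 fun s => boltz j Λ s (w a) * A.indicator 1 (Config.glue Λ.1 s (w a))
      else 0 := fun a => by
    split_ifs with h
    · rw [kernel_apply hj h hA, partitionFn_eq hj h]
      simp
    · simp [kernel_eq_zero hj h]
  simp_rw [e]
  exact Measurable.ite (hw.measurableSet_possible hj)
    ((hw.measurable_poissonInt_boltz hj measurable_const).inv.mul
      (hw.measurable_poissonInt_boltz hj (measurable_one.indicator hA))) measurable_const

theorem measurable_kernel (hj : IsAdmissible j) (Λ : Region d) {A : Set (Config d)}
    (hA : MeasurableSet A) : Measurable[Config.sigmaOn Λ.1ᶜ] fun ξ => kernel j Λ ξ A :=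
  @MeasurableOn.measurable_kernel d j hj (Config d) (Config.sigmaOn Λ.1ᶜ) (fun ξ => ξ) Λ
    (measurableOn_id Λ.1ᶜ) A hA

theorem kernel_proper (hj : IsAdmissible j) (Λ : Region d) {A : Set (Config d)}
    (hA : MeasurableSet[Config.sigmaOn Λ.1ᶜ] A) (ξ : Config d) :
    kernel j Λ ξ A = (A ∩ possible j Λ).indicator (fun _ => 1) ξ := by
  classical
  by_cases hξ : ξ ∈ possible j Λ
  · rw [kernel_apply hj hξ (sigmaOn_mono (subset_univ _) _ hA)]
    have : (poissonInt Λ.1 fun s => boltz j Λ s ξ * A.indicator 1 (Config.glue Λ.1 s ξ)) =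
        poissonInt Λ.1 fun s => A.indicator (fun _ => (1 : ℝ≥0∞)) ξ * boltz j Λ s ξ := by
      refine poissonInt_congr Λ.2.1 fun s hs => ?_
      rw [mul_comm]
      congr 1
      have := mem_iff_of_restrict_eq hA (Config.restrict_glue hs ξ)
      by_cases h : ξ ∈ A <;> simp [h, this]
    rw [this, poissonInt_const_mul, ← partitionFn_eq hj hξ, mul_left_comm,
      ENNReal.inv_mul_cancel (partitionFn_ne_zero hj hξ) (partitionFn_ne_top hj hξ), mul_one]
    · by_cases h : ξ ∈ A <;> simp [h, hξ]
    · by_cases h : ξ ∈ A <;> simp [h]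
  · simp [kernel_eq_zero hj hξ, hξ]

/-- After splitting Δ, fix the points y in Δ ∖ Λ. If y has weight zero, both sides vanish. Otherwise
`boltz_add` pulls out the weight of y; the inner kernel sees only the outside of Λ and so is
constant in x, and the integral over x gives Z_Λ, which cancels its normalization. -/
theorem kernel_consistent (hj : IsAdmissible j) (hR : 0 < interactionRange j) {Λ Δ : Region d}
    (hΛ : Λ.1 ⊆ Δ.1) {A : Set (Config d)} (hA : MeasurableSet A) (ξ : Config d) :
    ∫⁻ ζ, kernel j Λ ζ A ∂(kernel j Δ ξ) = kernel j Δ ξ A := by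
  by_cases hξ : ξ ∈ possible j Δ
  swap
  · simp [kernel_eq_zero hj hξ]
  have hG' := measurable_kernel hj Λ hA
  have hG : Measurable fun ζ => kernel j Λ ζ A := hG'.mono (sigmaOn_mono (subset_univ _)) le_rfl
  have hmt : ∀ {g : Config d → ℝ≥0∞}, Measurable g →
      MeasurableTuple fun s => boltz j Δ s ξ * g (Config.glue Δ.1 s ξ) := fun hg n =>
    (measurable_boltz_tuplePts hj Δ ξ n).mul (hg.comp (measurable_glue_tuplePts Δ ξ n))
  rw [lintegral_kernel hj hξ hG, kernel_apply hj hξ hA, poissonInt_split Λ.2.1 hΛ (hmt hG),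
    poissonInt_split Λ.2.1 hΛ (hmt (measurable_one.indicator hA))]
  congr 1
  refine poissonInt_congr (Δ.2.1.diff Λ.2.1) fun y hy => ?_
  by_cases hy0 : boltz j Δ y ξ = 0
  · simp [boltz_add_eq_zero hj _ hξ hy0]
  set ω := Config.glue Δ.1 y ξ with hω
  have hωp : ω ∈ possible j Λ := glue_mem_possible hj hΛ hy hy0
  have key : ∀ g : Config d → ℝ≥0∞,
      (poissonInt Λ.1 fun x => boltz j Δ (x + y) ξ * g (Config.glue Δ.1 (x + y) ξ)) =
        boltz j Δ y ξ * poissonInt Λ.1 fun x => boltz j Λ x ω * g (Config.glue Λ.1 x ω) := by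
    intro g
    rw [← poissonInt_const_mul (boltz_ne_top hj y hξ)]
    refine poissonInt_congr Λ.2.1 fun x hx => ?_
    rw [boltz_add hj hR hΛ hx hy hξ hy0, hω, Config.glue_glue hΛ hy]
    ring
  rw [key fun ζ => kernel j Λ ζ A, key]
  congr 1
  have h1 : (poissonInt Λ.1 fun x => boltz j Λ x ω * kernel j Λ (Config.glue Λ.1 x ω) A) =
      poissonInt Λ.1 fun x => kernel j Λ ω A * boltz j Λ x ω := by
    refine poissonInt_congr Λ.2.1 fun x hx => ?_
    rw [mul_comm, eq_of_restrict_eq hG' (Config.restrict_glue hx ω)]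
  have hp := isProbabilityMeasure_kernel hj hωp
  rw [h1, poissonInt_const_mul (measure_ne_top _ _), ← partitionFn_eq hj hωp,
    kernel_apply hj hωp hA, mul_comm, ← mul_assoc,
    ENNReal.mul_inv_cancel (partitionFn_ne_zero hj hωp) (partitionFn_ne_top hj hωp), one_mul]

theorem isSpecification_kernel (hj : IsAdmissible j) (hR : 0 < interactionRange j) :
    IsSpecification (possible j) (kernel j) where
  measurableSet_possible := measurableSet_possible hj
  isProbabilityMeasure _ _ hξ := isProbabilityMeasure_kernel hj hξ
  eq_zero _ _ hξ A _ := by simp [kernel_eq_zero hj hξ]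
  measurable Λ _ hA := measurable_kernel hj Λ hA
  proper Λ _ hA ξ := kernel_proper hj Λ hA ξ
  consistent _ _ h _ hA ξ := kernel_consistent hj hR h hA ξ

/-! ### The Andréief and Cauchy–Binet identities -/

/-- For fixed τ, the sum over σ is sign(τ) times the determinant with permuted columns, that is, the
determinant itself. This is the combinatorial core of both Andréief and Cauchy–Binet. -/
theorem sum_perm_perm_prod {n : ℕ} (M : Matrix (Fin n) (Fin n) ℂ) :
    ∑ σ : Equiv.Perm (Fin n), ∑ τ : Equiv.Perm (Fin n),
      ((Equiv.Perm.sign σ : ℤ) : ℂ) * ((Equiv.Perm.sign τ : ℤ) : ℂ) * ∏ l, M (σ l) (τ l) =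
      (n ! : ℂ) * M.det := by
  rw [Finset.sum_comm]
  have h : ∀ τ : Equiv.Perm (Fin n), ∑ σ : Equiv.Perm (Fin n),
      ((Equiv.Perm.sign σ : ℤ) : ℂ) * ((Equiv.Perm.sign τ : ℤ) : ℂ) * ∏ l, M (σ l) (τ l) =
      M.det := fun τ => by
    have h1 := Matrix.det_permute' τ M
    rw [Matrix.det_apply'] at h1
    have h2 : ∀ σ : Equiv.Perm (Fin n), ((Equiv.Perm.sign σ : ℤ) : ℂ) *
        ((Equiv.Perm.sign τ : ℤ) : ℂ) * ∏ l, M (σ l) (τ l) =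
        ((Equiv.Perm.sign τ : ℤ) : ℂ) * (((Equiv.Perm.sign σ : ℤ) : ℂ) *
          ∏ l, M.submatrix id τ (σ l) l) := fun σ => by
      simp only [Matrix.submatrix_apply, id]
      ring
    simp_rw [h2]
    rw [← Finset.mul_sum, h1, ← mul_assoc, ← Int.cast_mul, ← Units.val_mul, Int.units_mul_self]
    simp
  simp_rw [h]
  rw [Finset.sum_const, Finset.card_univ, Fintype.card_perm, Fintype.card_fin, nsmul_eq_mul]

theorem det_mul_det_eq_sum {n : ℕ} (A B : Matrix (Fin n) (Fin n) ℂ) :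
    A.det * B.det = ∑ σ : Equiv.Perm (Fin n), ∑ τ : Equiv.Perm (Fin n),
      ((Equiv.Perm.sign σ : ℤ) : ℂ) * ((Equiv.Perm.sign τ : ℤ) : ℂ) *
        ∏ l, A (σ l) l * B (τ l) l := by
  rw [Matrix.det_apply', Matrix.det_apply', Finset.sum_mul_sum]
  refine Finset.sum_congr rfl fun σ _ => Finset.sum_congr rfl fun τ _ => ?_
  rw [Finset.prod_mul_distrib]
  ring

theorem star_det_of {n : ℕ} (A : Fin n → Fin n → ℂ) :
    Matrix.det (Matrix.of fun a b => star (A a b)) = star (Matrix.det (Matrix.of A)) := by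
  rw [← Matrix.det_conjTranspose, ← Matrix.det_transpose]
  rfl

/-- Andréief's identity for the Gram matrix of `n` bounded functions. -/
theorem andreief {α : Type*} [MeasurableSpace α] (μ : Measure α) [IsFiniteMeasure μ] {n : ℕ}
    {f : Fin n → α → ℂ} (hf : ∀ a, Measurable (f a)) (hb : ∀ a, ∃ C, ∀ t, ‖f a t‖ ≤ C) :
    ((∫ t, Complex.normSq (Matrix.det (Matrix.of fun a l => f a (t l)))
      ∂(Measure.pi fun _ : Fin n => μ) : ℝ) : ℂ) =
      (n ! : ℂ) * Matrix.det (Matrix.of fun a b => ∫ t, f a t * star (f b t) ∂μ) ∧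
    Integrable (fun t : Fin n → α => Complex.normSq (Matrix.det (Matrix.of fun a l => f a (t l))))
      (Measure.pi fun _ : Fin n => μ) := by
  have hint : ∀ a b, Integrable (fun t => f a t * star (f b t)) μ := fun a b => by
    obtain ⟨C, hC⟩ := hb a
    obtain ⟨C', hC'⟩ := hb b
    refine Integrable.of_bound ((hf a).mul (continuous_star.measurable.comp (hf b))).aestronglyMeasurable (C * C')
      (Eventually.of_forall fun t => ?_)
    rw [norm_mul, norm_star]
    exact mul_le_mul (hC t) (hC' t) (norm_nonneg _) ((norm_nonneg _).trans (hC t))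
  have hprod : ∀ σ τ : Equiv.Perm (Fin n), Integrable
      (fun t : Fin n → α => ((Equiv.Perm.sign σ : ℤ) : ℂ) * ((Equiv.Perm.sign τ : ℤ) : ℂ) *
        ∏ l, f (σ l) (t l) * star (f (τ l) (t l))) (Measure.pi fun _ : Fin n => μ) := fun σ τ =>
    (Integrable.fintype_prod (f := fun l t => f (σ l) t * star (f (τ l) t))
      fun l => hint (σ l) (τ l)).const_mul _
  have hexp : ∀ t : Fin n → α,
      ((Complex.normSq (Matrix.det (Matrix.of fun a l => f a (t l))) : ℝ) : ℂ) =
      ∑ σ : Equiv.Perm (Fin n), ∑ τ : Equiv.Perm (Fin n),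
        ((Equiv.Perm.sign σ : ℤ) : ℂ) * ((Equiv.Perm.sign τ : ℤ) : ℂ) *
          ∏ l, f (σ l) (t l) * star (f (τ l) (t l)) := fun t => by
    rw [Complex.normSq_eq_conj_mul_self, mul_comm, ← RCLike.star_def, ← star_det_of,
      det_mul_det_eq_sum]
    rfl
  have hI : Integrable (fun t : Fin n → α =>
      ((Complex.normSq (Matrix.det (Matrix.of fun a l => f a (t l))) : ℝ) : ℂ))
      (Measure.pi fun _ : Fin n => μ) := by
    simp_rw [hexp]
    exact integrable_finsetSum _ fun σ _ => integrable_finsetSum _ fun τ _ => hprod σ τ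
  refine ⟨?_, by simpa using hI.re⟩
  rw [← integral_complex_ofReal]
  simp_rw [hexp]
  rw [integral_finsetSum _ fun σ _ => integrable_finsetSum _ fun τ _ => hprod σ τ,
    ← sum_perm_perm_prod]
  refine Finset.sum_congr rfl fun σ _ => ?_
  rw [integral_finsetSum _ fun τ _ => hprod σ τ]
  refine Finset.sum_congr rfl fun τ _ => ?_
  rw [integral_const_mul,
    integral_fintype_prod_eq_prod fun l t => f (σ l) t * star (f (τ l) t)]
  rfl

theorem ofReal_re_det_eq {α : Type*} [MeasurableSpace α] (μ : Measure α) [IsFiniteMeasure μ]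
    {n : ℕ} {f : Fin n → α → ℂ} (hf : ∀ a, Measurable (f a)) (hb : ∀ a, ∃ C, ∀ t, ‖f a t‖ ≤ C) :
    ENNReal.ofReal (Matrix.det (Matrix.of fun a b => ∫ t, f a t * star (f b t) ∂μ)).re =
      ((n ! : ℕ) : ℝ≥0∞)⁻¹ * ∫⁻ t, ENNReal.ofReal (Complex.normSq
        (Matrix.det (Matrix.of fun a l => f a (t l)))) ∂(Measure.pi fun _ : Fin n => μ) := by
  obtain ⟨h1, h2⟩ := andreief μ hf hb
  rw [← ofReal_integral_eq_lintegral_ofReal h2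
    (Eventually.of_forall fun _ => Complex.normSq_nonneg _)]
  have h3 := congrArg Complex.re h1
  have h4 : ((n ! : ℂ)) = ((n ! : ℝ) : ℂ) := by norm_cast
  rw [h4, Complex.ofReal_re, Complex.re_ofReal_mul] at h3
  rw [h3, ENNReal.ofReal_mul (by positivity), ENNReal.ofReal_natCast, ← mul_assoc,
    ENNReal.inv_mul_cancel (by exact_mod_cast n.factorial_ne_zero) (ENNReal.natCast_ne_top _),
    one_mul]

/-- By Andréief the determinant is a nonnegative real, so passing to extended nonnegative numbers
loses nothing. -/
theorem det_eq_ofReal {α : Type*} [MeasurableSpace α] (μ : Measure α) [IsFiniteMeasure μ]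
    {n : ℕ} {f : Fin n → α → ℂ} (hf : ∀ a, Measurable (f a)) (hb : ∀ a, ∃ C, ∀ t, ‖f a t‖ ≤ C) :
    Matrix.det (Matrix.of fun a b => ∫ t, f a t * star (f b t) ∂μ) =
      (((ENNReal.ofReal (Matrix.det
        (Matrix.of fun a b => ∫ t, f a t * star (f b t) ∂μ)).re).toReal : ℝ) : ℂ) := by
  obtain ⟨h1, h2⟩ := andreief μ hf hb
  have h0 : (0 : ℝ) < n ! := by exact_mod_cast n.factorial_pos
  have h4 : ((n ! : ℂ)) = ((n ! : ℝ) : ℂ) := by norm_cast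
  have hre := congrArg Complex.re h1
  have him := congrArg Complex.im h1
  rw [h4, Complex.ofReal_re, Complex.re_ofReal_mul] at hre
  rw [h4, Complex.ofReal_im, Complex.im_ofReal_mul] at him
  have hpos : 0 ≤ (n ! : ℝ) * (Matrix.det (Matrix.of fun a b =>
      ∫ t, f a t * star (f b t) ∂μ)).re := by
    rw [← hre]
    exact integral_nonneg fun _ => Complex.normSq_nonneg _
  rw [ENNReal.toReal_ofReal (nonneg_of_mul_nonneg_right hpos h0)]
  refine Complex.ext rfl ?_
  rw [Complex.ofReal_im]
  exact (mul_eq_zero.1 him.symm).resolve_left h0.ne'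

section Basis

variable {H : Type} [NormedAddCommGroup H] [InnerProductSpace ℂ H] {ι : Type}

/-- An enumeration of a set with `n` elements. -/
def enum {n : ℕ} (S : {S : Finset ι // S.card = n}) : Fin n ≃ S.1 :=
  (S.1.equivFinOfCardEq S.2).symm

-- Each n-subset has n! enumerations, and tuples with repetitions contribute nothing.
open Classical in
theorem sum_subsets_eq {n : ℕ} (I : Finset ι) {g : (Fin n → ι) → ℝ}
    (hg : ∀ f (σ : Equiv.Perm (Fin n)), g (f ∘ σ) = g f)
    (h0 : ∀ f, ¬ Function.Injective f → g f = 0) :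
    (n ! : ℝ) * ∑ S ∈ (Finset.powersetCard n I).subtype (fun S => S.card = n),
      g (fun l => (enum S l).1) = ∑ f ∈ Fintype.piFinset fun _ : Fin n => I, g f := by
  rw [← Finset.sum_of_injOn (s := ((Finset.powersetCard n I).subtype fun S => S.card = n) ×ˢ
      (Finset.univ : Finset (Equiv.Perm (Fin n))))
    (f := fun q => g (fun l => (enum q.1 l).1))
    (fun (q : {S : Finset ι // S.card = n} × Equiv.Perm (Fin n)) (l : Fin n) =>
      (enum q.1 (q.2 l)).1)]
  · rw [Finset.sum_product, Finset.mul_sum]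
    refine Finset.sum_congr rfl fun S _ => ?_
    have : ∑ _σ : Equiv.Perm (Fin n), g (fun l => (enum S l).1) =
        n ! * g (fun l => (enum S l).1) := by
      rw [Finset.sum_const, Finset.card_univ, Fintype.card_perm, Fintype.card_fin, nsmul_eq_mul]
    exact this.symm
  · rintro ⟨S, σ⟩ - ⟨S', σ'⟩ - h
    have him : ∀ (S : {S : Finset ι // S.card = n}) (σ : Equiv.Perm (Fin n)),
        Finset.univ.image (fun l => (enum S (σ l)).1) = S.1 := fun S σ => by
      ext i
      simp only [Finset.mem_image, Finset.mem_univ, true_and]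
      constructor
      · rintro ⟨l, rfl⟩
        exact (enum S (σ l)).2
      · intro hi
        exact ⟨σ.symm ((enum S).symm ⟨i, hi⟩), by simp⟩
    have hS : S = S' := Subtype.ext (by rw [← him S σ, ← him S' σ']; exact congrArg (fun f => Finset.univ.image f) h)
    subst hS
    congr 1
    ext1 l
    have := congrFun h l
    exact (enum S).injective (Subtype.ext this)
  · rintro ⟨S, σ⟩ hS
    simp only [Finset.coe_product, mem_prod, Finset.mem_coe, Finset.mem_subtype,
      Finset.mem_powersetCard] at hS
    simp only [Finset.mem_coe, Fintype.mem_piFinset]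
    exact fun l => hS.1.1 (enum S (σ l)).2
  · intro f hf hn
    refine h0 f fun hinj => hn ?_
    rw [Fintype.mem_piFinset] at hf
    let S : {S : Finset ι // S.card = n} :=
      ⟨Finset.univ.image f, by rw [Finset.card_image_of_injective _ hinj]; simp⟩
    have hmem : ∀ l, f l ∈ S.1 := fun l => Finset.mem_image_of_mem _ (Finset.mem_univ l)
    have hinj' : Function.Injective fun l => (enum S).symm ⟨f l, hmem l⟩ := fun a b hab => by
      have := (enum S).symm.injective hab
      exact hinj (Subtype.ext_iff.1 this)
    let σ : Equiv.Perm (Fin n) := Equiv.ofBijective _ (Finite.injective_iff_bijective.1 hinj')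
    refine ⟨(S, σ), ?_, ?_⟩
    · simp only [Finset.coe_product, mem_prod, Finset.mem_coe, Finset.mem_subtype,
        Finset.mem_powersetCard, Finset.mem_univ, and_true]
      refine ⟨?_, S.2⟩
      intro i hi
      obtain ⟨l, -, rfl⟩ := Finset.mem_image.1 hi
      exact hf l
    · ext1 l
      simp [σ]
  · rintro ⟨S, σ⟩ -
    exact (hg (fun l => (enum S l).1) σ).symm

open Classical in
/-- The Cauchy–Binet identity for finitely many vectors of an orthonormal basis. -/
theorem sum_normSq_det_eq {n : ℕ} (e : ι → H) (v : Fin n → H) (I : Finset ι) :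
    (((∑ S ∈ (Finset.powersetCard n I).subtype (fun S => S.card = n),
      Complex.normSq (Matrix.det (Matrix.of fun a l : Fin n =>
        inner ℂ (e (enum S a).1) (v l))) : ℝ)) : ℂ) =
      Matrix.det (Matrix.of fun a b => ∑ i ∈ I, inner ℂ (v a) (e i) * inner ℂ (e i) (v b)) := by
  have h1 := sum_subsets_eq I (g := fun f => Complex.normSq (Matrix.det
    (Matrix.of fun a l : Fin n => inner ℂ (e (f a)) (v l)))) ?_ ?_
  · have h0 : (n ! : ℂ) ≠ 0 := by exact_mod_cast n.factorial_ne_zero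
    refine mul_left_cancel₀ h0 ?_
    rw [← sum_perm_perm_prod]
    have h2 := congrArg (fun r : ℝ => (r : ℂ)) h1
    push_cast at h2 ⊢
    rw [h2]
    have h3 : ∀ f : Fin n → ι, ((Complex.normSq (Matrix.det
        (Matrix.of fun a l : Fin n => inner ℂ (e (f a)) (v l))) : ℝ) : ℂ) =
        ∑ σ : Equiv.Perm (Fin n), ∑ τ : Equiv.Perm (Fin n),
          ((Equiv.Perm.sign σ : ℤ) : ℂ) * ((Equiv.Perm.sign τ : ℤ) : ℂ) *
            ∏ l, inner ℂ (v (σ l)) (e (f l)) * inner ℂ (e (f l)) (v (τ l)) := fun f => by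
      have := det_mul_det_eq_sum (Matrix.of fun l a : Fin n => inner ℂ (v l) (e (f a)))
        (Matrix.of fun l a : Fin n => inner ℂ (e (f a)) (v l))
      simp only [Matrix.of_apply] at this
      rw [← this, Complex.normSq_eq_conj_mul_self, ← RCLike.star_def, ← star_det_of]
      congr 1
      · rw [← Matrix.det_transpose]
        congr 1
        ext a b
        simp
      · rw [← Matrix.det_transpose]
        congr 1
    simp_rw [h3]
    rw [Finset.sum_comm]
    refine Finset.sum_congr rfl fun σ _ => ?_
    rw [Finset.sum_comm]
    refine Finset.sum_congr rfl fun τ _ => ?_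
    rw [← Finset.mul_sum]
    simp only [Matrix.of_apply]
    rw [Finset.prod_univ_sum]
  · intro f σ
    have h2 := Matrix.det_permute σ (Matrix.of fun a l : Fin n => inner ℂ (e (f a)) (v l))
    have h3 : (Matrix.of fun a l : Fin n => inner ℂ (e ((f ∘ σ) a)) (v l)) =
      (Matrix.of fun a l : Fin n => inner ℂ (e (f a)) (v l)).submatrix σ id := rfl
    rw [h3, h2, Complex.normSq_mul]
    rcases Int.units_eq_one_or (Equiv.Perm.sign σ) with h | h <;> simp [h]
  · intro f hf
    simp only [Function.Injective, not_forall] at hf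
    obtain ⟨a, b, hab, hne⟩ := hf
    rw [Matrix.det_zero_of_row_eq hne]
    · simp
    · ext l
      simp [hab]

/-- The Cauchy–Binet identity for an orthonormal basis. -/
theorem tsum_normSq_det_eq {n : ℕ} (e : HilbertBasis ι ℂ H) (v : Fin n → H) :
    ∑' S : {S : Finset ι // S.card = n}, ENNReal.ofReal (Complex.normSq (Matrix.det
      (Matrix.of fun a l : Fin n => inner ℂ (e (enum S a).1) (v l)))) =
      ENNReal.ofReal (Matrix.det (Matrix.of fun a b => inner ℂ (v a) (v b))).re := by
  classical
  -- The n-subsets of a growing finite index set exhaust all n-subsets, so the finite identity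
  -- passes to the limit, with Parseval giving the entries on the right.
  have hP : Tendsto (fun I : Finset ι => (Finset.powersetCard n I).subtype (fun S => S.card = n))
      atTop atTop := by
    refine tendsto_atTop_finset_of_monotone (fun I I' h S hS => ?_) fun S => ⟨S.1, ?_⟩
    · simp only [Finset.mem_subtype, Finset.mem_powersetCard] at hS ⊢
      exact ⟨hS.1.trans h, hS.2⟩
    · simp only [Finset.mem_subtype, Finset.mem_powersetCard]
      exact ⟨subset_rfl, S.2⟩
  have h1 := (ENNReal.summable (f := fun S : {S : Finset ι // S.card = n} => ENNReal.ofReal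
    (Complex.normSq (Matrix.det (Matrix.of fun a l : Fin n =>
      inner ℂ (e (enum S a).1) (v l)))))).hasSum.comp hP
  refine tendsto_nhds_unique h1 ?_
  have h2 : Tendsto (fun I : Finset ι => Matrix.det (Matrix.of fun a b : Fin n =>
      ∑ i ∈ I, inner ℂ (v a) (e i) * inner ℂ (e i) (v b))) atTop
      (𝓝 (Matrix.det (Matrix.of fun a b => inner ℂ (v a) (v b)))) := by
    have hc : Continuous fun M : Matrix (Fin n) (Fin n) ℂ => M.det := continuous_id.matrix_det
    refine (hc.tendsto _).comp ?_
    refine tendsto_pi_nhds.2 fun a => tendsto_pi_nhds.2 fun b => ?_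
    exact e.hasSum_inner_mul_inner (v a) (v b)
  refine ((ENNReal.continuous_ofReal.comp Complex.continuous_re).tendsto _).comp h2 |>.congr ?_
  intro I
  simp only [Function.comp]
  rw [← sum_normSq_det_eq (fun i => e i) v I, Complex.ofReal_re,
    ENNReal.ofReal_sum_of_nonneg fun _ _ => Complex.normSq_nonneg _]

/-- Balls of radius 1/2 around the basis vectors are disjoint. Countability is needed to exchange
the sum over subsets with the integral. -/
theorem HilbertBasis.countable_index [SecondCountableTopology H] (e : HilbertBasis ι ℂ H) :
    Countable ι := by
  have hd : ∀ i k, i ≠ k → 1 ≤ dist (e i) (e k) := fun i k hik => by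
    have h1 : ‖e i - e k‖ ^ 2 = 2 := by
      rw [@norm_sub_sq ℂ, e.orthonormal.1 i, e.orthonormal.1 k, e.orthonormal.2 hik]
      norm_num
    rw [dist_eq_norm]
    nlinarith [norm_nonneg (e i - e k)]
  refine Set.countable_univ_iff.1 (Set.PairwiseDisjoint.countable_of_isOpen
    (s := fun i => Metric.ball (e i) (1 / 2)) ?_ (fun _ _ => Metric.isOpen_ball)
    fun i _ => ⟨e i, Metric.mem_ball_self (by norm_num)⟩)
  intro i _ k _ hik
  exact Metric.ball_disjoint_ball (by linarith [hd i k hik])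

end Basis

/-! ### The trace formula for the restricted operator -/

theorem measurable_character (t : Pt d) : Measurable (character t) :=
  (continuous_character.comp (by fun_prop : Continuous fun x : Pt d => (t, x))).measurable

theorem measurable_character_left (x : Pt d) : Measurable fun t => character t x :=
  (continuous_character.comp (by fun_prop : Continuous fun t : Pt d => (t, x))).measurable

theorem Region.isFiniteMeasure_restrict (Λ : Region d) :
    IsFiniteMeasure ((volume : Measure (Pt d)).restrict Λ.1) :=
  ⟨by rw [Measure.restrict_apply_univ]; exact Λ.2.2.measure_lt_top⟩

theorem memLp_character (Λ : Region d) (t : Pt d) :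
    MemLp (Λ.1.indicator (character t)) 2 volume := by
  have := Λ.isFiniteMeasure_restrict
  rw [memLp_indicator_iff_restrict Λ.2.1]
  exact MemLp.of_bound (measurable_character t).aestronglyMeasurable 1 (by simp)

/-- The plane wave `1_Λ(x) exp(i x·t)`. -/
def planeWave (Λ : Region d) (t : Pt d) : L2 d := (memLp_character Λ t).toLp _

theorem integrable_indicator_Lp (Λ : Region d) (f : L2 d) :
    Integrable (Λ.1.indicator (f : Pt d → ℂ)) := by
  have := Λ.isFiniteMeasure_restrict
  rw [integrable_indicator_iff Λ.2.1]
  exact (((Lp.memLp f).restrict Λ.1).integrable (by norm_num))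

theorem integrable_star_indicator_Lp (Λ : Region d) (f : L2 d) :
    Integrable (fun x => star (Λ.1.indicator (f : Pt d → ℂ) x)) :=
  (integrable_indicator_Lp Λ f).mono
    (continuous_star.comp_aestronglyMeasurable (integrable_indicator_Lp Λ f).1)
    (Eventually.of_forall fun _ => (norm_star _).le)

theorem inner_planeWave (Λ : Region d) (f : L2 d) (t : Pt d) :
    inner ℂ f (planeWave Λ t) =
      ∫ x, star (Λ.1.indicator (f : Pt d → ℂ) x) * character t x := by
  rw [L2.inner_def]
  refine integral_congr_ae ?_
  filter_upwards [MemLp.coeFn_toLp (memLp_character Λ t)] with x hx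
  rw [planeWave, hx, RCLike.inner_apply]
  by_cases h : x ∈ Λ.1 <;> simp [h, mul_comm]

/-- The double star puts the integrand in the form f · star g required by Andréief, with f and g
conjugate characters. -/
theorem inner_planeWave_planeWave (Λ : Region d) (s t : Pt d) :
    inner ℂ (planeWave Λ s) (planeWave Λ t) =
      ∫ x in Λ.1, star (character s x) * star (star (character t x)) := by
  rw [inner_planeWave, ← integral_indicator Λ.2.1]
  refine integral_congr_ae ?_
  filter_upwards [MemLp.coeFn_toLp (memLp_character Λ s)] with x hx
  by_cases h : x ∈ Λ.1
  · rw [planeWave, indicator_of_mem h, indicator_of_mem h, hx, indicator_of_mem h, star_star]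
  · rw [indicator_of_notMem h, indicator_of_notMem h]
    simp

theorem continuous_inner_planeWave (Λ : Region d) (f : L2 d) :
    Continuous fun t => inner ℂ f (planeWave Λ t) := by
  simp_rw [inner_planeWave]
  have hF := integrable_star_indicator_Lp Λ f
  refine continuous_of_dominated (bound := fun x => ‖star (Λ.1.indicator (f : Pt d → ℂ) x)‖)
    (fun t => hF.1.mul (measurable_character t).aestronglyMeasurable) ?_ hF.norm ?_
  · intro t
    refine Eventually.of_forall fun x => ?_
    rw [norm_mul, norm_character, mul_one]
  · refine Eventually.of_forall fun x => continuous_const.mul ?_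
    exact continuous_character.comp (by fun_prop : Continuous fun t : Pt d => (t, x))

theorem norm_inner_planeWave_le (Λ : Region d) (f : L2 d) :
    ∃ C, ∀ t, ‖inner ℂ f (planeWave Λ t)‖ ≤ C := by
  refine ⟨∫ x, ‖star (Λ.1.indicator (f : Pt d → ℂ) x)‖, fun t => ?_⟩
  rw [inner_planeWave]
  refine (norm_integral_le_integral_norm _).trans_eq ?_
  simp

theorem coeFn_proj (Λ : Region d) (f : L2 d) :
    proj Λ f =ᵐ[volume] Λ.1.indicator (f : Pt d → ℂ) := MemLp.coeFn_toLp (memLp_mask Λ f)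

/-- Inserting j(x - y) = ∫ exp(ix·t) star(exp(iy·t)) dμ(t) and exchanging integrals separates x from
y. Fubini applies because the characters are unimodular, μ is finite and functions in L² are
integrable on the bounded set Λ. -/
theorem inner_restrictedOp (hj : IsAdmissible j) {μ : Measure (Pt d)} [IsFiniteMeasure μ]
    (hμ : ∀ x, j x = ∫ t, character t x ∂μ) (Λ : Region d) (f g : L2 d) :
    inner ℂ f (restrictedOp j hj.integrable Λ g) =
      ∫ t, inner ℂ f (planeWave Λ t) * star (inner ℂ g (planeWave Λ t)) ∂μ := by
  set F : Pt d → ℂ := fun x => star (Λ.1.indicator (f : Pt d → ℂ) x) with hFdef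
  set G : Pt d → ℂ := Λ.1.indicator (g : Pt d → ℂ) with hGdef
  have hF : Integrable F := integrable_star_indicator_Lp Λ f
  have hG : Integrable G := integrable_indicator_Lp Λ g
  have h1 : inner ℂ f (restrictedOp j hj.integrable Λ g) = ∫ x, F x * ∫ y, j (x - y) * G y := by
    rw [L2.inner_def]
    refine integral_congr_ae ?_
    have e := integralOp_apply j hj.integrable (proj Λ g)
    filter_upwards [coeFn_proj Λ (integralOp j hj.integrable (proj Λ g)), e] with x hx hx'
    have hG' : ∫ y, j (x - y) * (proj Λ g : Pt d → ℂ) y = ∫ y, j (x - y) * G y := by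
      refine integral_congr_ae ?_
      filter_upwards [coeFn_proj Λ g] with y hy
      rw [hy]
    rw [restrictedOp, ContinuousLinearMap.comp_apply, ContinuousLinearMap.comp_apply, hx,
      RCLike.inner_apply]
    by_cases h : x ∈ Λ.1
    · rw [indicator_of_mem h, hx', hG', hFdef]
      simp only [indicator_of_mem h]
      rw [mul_comm]
      rfl
    · rw [indicator_of_notMem h, hFdef]
      simp [h]
  have h2 : ∀ t, inner ℂ f (planeWave Λ t) * star (inner ℂ g (planeWave Λ t)) =
      ∫ z : Pt d × Pt d, (F z.1 * character t z.1) * (G z.2 * star (character t z.2))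
        ∂((volume : Measure (Pt d)).prod volume) := fun t => by
    rw [integral_prod_mul (fun x => F x * character t x) (fun y => G y * star (character t y)),
      inner_planeWave, inner_planeWave]
    congr 1
    rw [RCLike.star_def, ← integral_conj]
    refine integral_congr_ae (Eventually.of_forall fun y => ?_)
    simp [hGdef]
  have h3 : ∀ (t : Pt d) (z : Pt d × Pt d),
      (F z.1 * character t z.1) * (G z.2 * star (character t z.2)) =
        (F z.1 * G z.2) * character t (z.1 - z.2) := fun t z => by
    rw [character_sub]
    ring
  have hFG : Integrable (fun z : Pt d × Pt d => F z.1 * G z.2)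
      ((volume : Measure (Pt d)).prod volume) := hF.mul_prod hG
  have hc : Continuous fun q : Pt d × (Pt d × Pt d) => character q.1 (q.2.1 - q.2.2) :=
    continuous_character.comp
      (by fun_prop : Continuous fun q : Pt d × (Pt d × Pt d) => (q.1, q.2.1 - q.2.2))
  have hint : Integrable (Function.uncurry fun (t : Pt d) (z : Pt d × Pt d) =>
      (F z.1 * G z.2) * character t (z.1 - z.2))
      (μ.prod ((volume : Measure (Pt d)).prod volume)) := by
    have := (hFG.comp_snd μ).mul_bdd (c := 1) hc.aestronglyMeasurable
      (Eventually.of_forall fun q => by simp)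
    exact this
  have h4 : ∀ z : Pt d × Pt d, ∫ t, (F z.1 * G z.2) * character t (z.1 - z.2) ∂μ =
      F z.1 * (j (z.1 - z.2) * G z.2) := fun z => by
    rw [integral_const_mul, ← hμ]
    ring
  have h5 : Integrable (fun z : Pt d × Pt d => F z.1 * (j (z.1 - z.2) * G z.2))
      ((volume : Measure (Pt d)).prod volume) := by
    refine hint.integral_prod_right.congr (Eventually.of_forall fun z => ?_)
    exact h4 z
  rw [h1]
  simp_rw [h2, h3]
  rw [integral_integral_swap hint]
  simp_rw [h4]
  rw [integral_prod _ h5]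
  refine integral_congr_ae (Eventually.of_forall fun x => ?_)
  exact (integral_const_mul _ _).symm

/-! ### Traces of exterior powers and the Fredholm determinant. -/

theorem gram_tuplePts_eq {μ : Measure (Pt d)} [IsFiniteMeasure μ]
    (hμ : ∀ x, j x = ∫ t, character t x ∂μ) {n : ℕ} (x : Fin n → Pt d) :
    gram j (tuplePts x) = ((n ! : ℕ) : ℝ≥0∞)⁻¹ *
      ∫⁻ t, ENNReal.ofReal (Complex.normSq (Matrix.det (Matrix.of fun a l : Fin n =>
        character (t l) (x a)))) ∂(Measure.pi fun _ : Fin n => μ) := by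
  rw [← ofReal_re_det_eq μ (f := fun a t => character t (x a))
    (fun a => measurable_character_left _) (fun a => ⟨1, fun t => by simp⟩), gram,
    gramDet_tuplePts]
  congr 4
  ext a b
  rw [hμ]
  exact integral_congr_ae (Eventually.of_forall fun t => character_sub t _ _)

/-- Conjugation and transposition exchange the roles of the frequencies t and the positions x. -/
theorem normSq_det_star_character {n : ℕ} (t x : Fin n → Pt d) :
    Complex.normSq (Matrix.det (Matrix.of fun a l : Fin n => star (character (t a) (x l)))) =
      Complex.normSq (Matrix.det (Matrix.of fun a l : Fin n => character (t l) (x a))) := by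
  rw [star_det_of fun a l => character (t a) (x l), ← Matrix.det_transpose, RCLike.star_def,
    Complex.normSq_conj]
  rfl

theorem continuous_normSq_det_character (n : ℕ) :
    Continuous fun q : (Fin n → Pt d) × (Fin n → Pt d) => Complex.normSq (Matrix.det
      (Matrix.of fun a l : Fin n => character (q.1 l) (q.2 a))) := by
  have h : ∀ a l : Fin n, Continuous fun q : (Fin n → Pt d) × (Fin n → Pt d) =>
      character (q.1 l) (q.2 a) := fun a l => by
    have h1 : Continuous fun q : (Fin n → Pt d) × (Fin n → Pt d) => (q.1 l, q.2 a) := by fun_prop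
    exact continuous_character.comp h1
  have h2 : Continuous fun q : (Fin n → Pt d) × (Fin n → Pt d) => Matrix.det
      (Matrix.of fun a l : Fin n => character (q.1 l) (q.2 a)) :=
    (continuous_matrix h).matrix_det
  exact Complex.continuous_normSq.comp h2

theorem lintegral_normSq_det_character_swap (μ ν : Measure (Pt d)) [IsFiniteMeasure μ]
    [IsFiniteMeasure ν] {n : ℕ} :
    ∫⁻ t : Fin n → Pt d, ∫⁻ x : Fin n → Pt d, ENNReal.ofReal (Complex.normSq (Matrix.det
      (Matrix.of fun a l : Fin n => star (character (t a) (x l)))))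
        ∂(Measure.pi fun _ : Fin n => ν) ∂(Measure.pi fun _ : Fin n => μ) =
    ∫⁻ x : Fin n → Pt d, ∫⁻ t : Fin n → Pt d, ENNReal.ofReal (Complex.normSq (Matrix.det
      (Matrix.of fun a l : Fin n => character (t l) (x a))))
        ∂(Measure.pi fun _ : Fin n => μ) ∂(Measure.pi fun _ : Fin n => ν) := by
  simp_rw [normSq_det_star_character]
  have hm := (ENNReal.continuous_ofReal.comp (continuous_normSq_det_character (d := d) n)).measurable
  exact lintegral_lintegral_swap hm.aemeasurable

/-- The traces of the exterior powers of the restricted operator. -/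
theorem tsum_ofReal_det (hj : IsAdmissible j) (Λ : Region d) (n : ℕ) {ι : Type}
    (e : HilbertBasis ι ℂ (L2 d)) :
    ∑' S : {S : Finset ι // S.card = n}, ENNReal.ofReal (Matrix.det (Matrix.of fun a b : Fin n =>
      inner ℂ (e (enum S a).1) (restrictedOp j hj.integrable Λ (e (enum S b).1)))).re =
      ((n ! : ℕ) : ℝ≥0∞)⁻¹ * ∫⁻ x in cube Λ.1 n, gram j (tuplePts x) := by
  obtain ⟨μ, hμ, hj'⟩ := hj.exists_measure
  have hfac : Fact ((2 : ℝ≥0∞) ≠ ∞) := ⟨by simp⟩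
  have hcount : Countable ι := HilbertBasis.countable_index e
  have := Λ.isFiniteMeasure_restrict
  have hm : ∀ i, Measurable fun t => inner ℂ (e i) (planeWave Λ t) := fun i =>
    (continuous_inner_planeWave Λ (e i)).measurable
  simp_rw [inner_restrictedOp hj hj' Λ]
  simp_rw [fun S : {S : Finset ι // S.card = n} => ofReal_re_det_eq μ
    (f := fun a t => inner ℂ (e (enum S a).1) (planeWave Λ t))
    (fun a => hm _) (fun a => norm_inner_planeWave_le Λ _)]
  rw [ENNReal.tsum_mul_left, ← lintegral_tsum]
  swap
  · intro S
    have hdet : Measurable fun t : Fin n → Pt d => Matrix.det (Matrix.of fun a l : Fin n =>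
        inner ℂ (e (enum S a).1) (planeWave Λ (t l))) := by
      have hc : Continuous fun t : Fin n → Pt d => Matrix.det (Matrix.of fun a l : Fin n =>
          inner ℂ (e (enum S a).1) (planeWave Λ (t l))) :=
        Continuous.matrix_det (continuous_matrix fun a l =>
          (continuous_inner_planeWave Λ (e (enum S a).1)).comp (continuous_apply l))
      exact hc.measurable
    exact (ENNReal.measurable_ofReal.comp
      (Complex.continuous_normSq.measurable.comp hdet)).aemeasurable
  congr 1
  -- Cauchy–Binet removes the basis, leaving the Gram determinant of n plane waves; Andréief over Λ
  -- then expands it in positions.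
  simp_rw [fun t : Fin n → Pt d => tsum_normSq_det_eq e fun l => planeWave Λ (t l),
    inner_planeWave_planeWave]
  simp_rw [fun t : Fin n → Pt d => ofReal_re_det_eq (volume.restrict Λ.1)
    (f := fun a x => star (character (t a) x))
    (fun a => continuous_star.measurable.comp (measurable_character _))
    (fun a => ⟨1, fun x => by simp⟩)]
  simp_rw [gram_tuplePts_eq hj']
  have hne : ((n ! : ℕ) : ℝ≥0∞)⁻¹ ≠ ∞ :=
    ENNReal.inv_ne_top.2 (by exact_mod_cast n.factorial_ne_zero)
  rw [lintegral_const_mul' _ _ hne, lintegral_const_mul' _ _ hne, cube, volume_pi,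
    Measure.restrict_pi_pi]
  congr 1
  exact lintegral_normSq_det_character_swap _ _

theorem poissonInt_term_ne_top (hj : IsAdmissible j) (Λ : Region d) (n : ℕ) :
    ((n ! : ℕ) : ℝ≥0∞)⁻¹ * ∫⁻ x in cube Λ.1 n, gram j (tuplePts x) ≠ ∞ :=
  ne_top_of_le_ne_top (poissonInt_gram_ne_top hj Λ) (ENNReal.le_tsum n)

theorem hasExteriorTrace_restrictedOp (hj : IsAdmissible j) (Λ : Region d) (n : ℕ) :
    HasExteriorTrace (restrictedOp j hj.integrable Λ) n
      (((((n ! : ℕ) : ℝ≥0∞)⁻¹ * ∫⁻ x in cube Λ.1 n, gram j (tuplePts x)).toReal : ℝ) : ℂ) := by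
  intro ι e
  obtain ⟨μ, hμ, hj'⟩ := hj.exists_measure
  have h1 := tsum_ofReal_det hj Λ n e
  have h2 := ENNReal.hasSum_toReal (h1.trans_ne (poissonInt_term_ne_top hj Λ n))
  rw [← ENNReal.tsum_toReal_eq fun _ => ENNReal.ofReal_ne_top, h1] at h2
  refine (Complex.hasSum_ofReal.2 h2).congr_fun fun S => ?_
  have h3 := det_eq_ofReal μ (f := fun a t => inner ℂ (e (enum S a).1) (planeWave Λ t))
    (fun a => (continuous_inner_planeWave Λ (e (enum S a).1)).measurable)
    (fun a => norm_inner_planeWave_le Λ _)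
  simp_rw [← inner_restrictedOp hj hj' Λ] at h3
  rw [← h3]
  have hdet : ∀ (_ : DecidableEq S.1) (M : Matrix S.1 S.1 ℂ),
      (M.submatrix (enum S) (enum S)).det = M.det := fun _ M =>
    Matrix.det_submatrix_equiv_self (enum S) M
  exact (hdet _ _).symm

theorem hasFredholmDet_restrictedOp (hj : IsAdmissible j) (Λ : Region d) :
    HasFredholmDet (restrictedOp j hj.integrable Λ)
      (((poissonInt Λ.1 (gram j)).toReal : ℝ) : ℂ) := by
  refine ⟨_, hasExteriorTrace_restrictedOp hj Λ, Complex.hasSum_ofReal.2 ?_⟩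
  have h := ENNReal.hasSum_toReal (poissonInt_gram_ne_top hj Λ)
  rwa [← ENNReal.tsum_toReal_eq (poissonInt_term_ne_top hj Λ)] at h

end

end DetGibbs

theorem mainTheorem2 (d : ℕ) (j : Pt d → ℂ) (hj : IsAdmissible j) (hR : 0 < interactionRange j) :
    -- existence of the energy as a monotone limit
    (∀ (Λ : Region d), ∀ ζ ∈ simpleIn Λ.1, ∀ ξ ∈ possible j Λ,
      Monotone (fun Δ : Region d => hamOn j Λ Δ ζ ξ) ∧
      Tendsto (fun Δ : Region d => hamOn j Λ Δ ζ ξ) atTop (𝓝 (ham j Λ ζ ξ))) ∧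
    -- the integrands in the definitions below are measurable
    (∀ (Λ : Region d) (ξ : Config d) (n : ℕ),
      Measurable fun x : Fin n → Pt d => ham j Λ (tuplePts x) ξ) ∧
    -- bounds for the partition function
    (∀ Λ : Region d, ∃ D : ℝ, HasFredholmDet (restrictedOp j hj.integrable Λ) (D : ℂ) ∧
      ∀ ξ ∈ possible j Λ, 1 ≤ partitionFn j Λ ξ ∧ partitionFn j Λ ξ ≤ ENNReal.ofReal D) ∧
    -- the kernels act on bounded measurable functions by the defining formula
    (∀ (Λ : Region d) (ξ : Config d) (f : Config d → ℝ), Measurable f → (∃ C, ∀ ζ, |f ζ| ≤ C) →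
      HasSum (fun n : ℕ => ((n.factorial : ℕ) : ℝ)⁻¹ *
        ∫ x in cube Λ.1 n, (density j Λ (tuplePts x) ξ).toReal *
          f (Config.glue Λ.1 (tuplePts x) ξ)) (∫ ζ, f ζ ∂(kernel j Λ ξ))) ∧
    -- the kernels form a specification
    IsSpecification (possible j) (kernel j) := by
  refine ⟨fun Λ ζ hζ ξ hξ => ⟨monotone_hamOn hj ζ hξ, tendsto_hamOn hj hζ hξ⟩,
    measurable_ham hj, fun Λ => ⟨_, hasFredholmDet_restrictedOp hj Λ, fun ξ hξ =>
      ⟨one_le_partitionFn hj hξ, ?_⟩⟩, fun Λ ξ f hf hb => hasSum_integral_kernel hj Λ ξ hf hb,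
    isSpecification_kernel hj hR⟩
  rw [ENNReal.ofReal_toReal (poissonInt_gram_ne_top hj Λ)]
  exact partitionFn_le hj hξ
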